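/- Let $A:\mathbb R\to\mathbb R$ be infinitely differentiable, vanishing exponentially fast at $+\infty$ (there is $c>0$ with $A(x)=O(e^{-cx})$ as $x\to+\infty$), and satisfying the orthogonality relation $\int_{\mathbb R}A(r+x)A(r+y)\,dr=\delta(x-y)$ in the sense of distributions, i.e. for all $\varphi,\psi\in C_c^\infty(\mathbb R)$ the function $r\mapsto\big(\int A(r+x)\varphi(x)dx\big)\big(\int A(r+y)\psi(y)dy\big)$ is integrable on $\mathbb R$ with integral $\int\varphi\psi$. For $s\in\mathbb R$ let $A_s$ and $K_s$ be the integral operators on $L^2(\mathbb R_+)$ with kernels $$A_s(x,y)=A(x+y+s),\qquad K_s(x,y)=\int_0^\infty A(x+r+s)A(y+r+s)\,dr ,$$ and let $$\mathrm{Det}(I-K_s)=1+\sum_{n\ge1}\frac{(-1)^n}{n!}\int_{\mathbb R_+^n}\det\big[K_s(x_i,x_j)\big]_{i,j=1}^n\,dx_1\cdots dx_n .$$ Then for every $s\in\mathbb R$ the operator $I-K_s$ is invertible on $L^2(\mathbb R_+)$, the integrals and the series defining $\mathrm{Det}(I-K_s)$ converge absolutely, and $\mathrm{Det}(I-K_s)>0$.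 Define $$u_0(s)=\iint_{\mathbb R_+^2}A(s+y)\,(I-K_s)^{-1}(y,z)\,A(z+s)\,dy\,dz=\big\langle a_s,(I-K_s)^{-1}a_s\big\rangle_{L^2(\mathbb R_+)},$$ $$q_0(s)=\int_{\mathbb R_+}A(s+y)\,(I-K_s)^{-1}(y,0)\,dy=A(s)+\big\langle a_s,(I-K_s)^{-1}K_s(\cdot,0)\big\rangle_{L^2(\mathbb R_+)},$$ where $a_s(x)=A(x+s)$ and $(I-K_s)^{-1}(y,0)=\delta(y)+\big((I-K_s)^{-1}K_s(\cdot,0)\big)(y)$, the point mass at $y=0$ being counted fully. Then $s\mapsto\log\mathrm{Det}(I-K_s)$ is twice differentiable on $\mathbb R$, and for every $s\in\mathbb R$ $$\partial_s\log\mathrm{Det}(I-K_s)=u_0(s),\qquad \partial_s^2\log\mathrm{Det}(I-K_s)=-q_0(s)^2 .$$ Moreover $u_0$ is integrable on $(s,\infty)$ and $$\mathrm{Det}(I-K_s)=\exp\Big(-\int_s^{\infty}u_0(t)\,dt\Big).$$ -/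

import Mathlib

open MeasureTheory Set Filter
open scoped ContDiff ENNReal

noncomputable section

namespace TauRep

/-- Lebesgue measure on the half-line `ℝ₊ = (0, ∞)`. -/
abbrev halfLine : Measure ℝ := volume.restrict (Ioi (0 : ℝ))

/-- The real Hilbert space `L²(ℝ₊)`. -/
abbrev L2 : Type := Lp ℝ 2 halfLine

/-- The kernel `A_s(x, y) = A(x + y + s)`. -/
def aKernel (A : ℝ → ℝ) (s x y : ℝ) : ℝ := A (x + y + s)

/-- The kernel `K_s(x, y) = ∫₀^∞ A(x + r + s) A(y + r + s) dr`. -/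
def kKernel (A : ℝ → ℝ) (s x y : ℝ) : ℝ :=
  ∫ r in Ioi (0 : ℝ), aKernel A s x r * aKernel A s y r

/-- Standing assumptions on `A : ℝ → ℝ`: it is infinitely differentiable, it vanishes
exponentially fast at `+∞`, and `∫ A(r + x) A(r + y) dr = δ(x - y)` as distributions in `(x, y)`. -/
structure Admissible (A : ℝ → ℝ) : Prop where
  smooth : ContDiff ℝ ∞ A
  decay : ∃ c : ℝ, 0 < c ∧ A =O[atTop] fun x => Real.exp (-c * x)
  orthogonal : ∀ φ ψ : ℝ → ℝ, ContDiff ℝ ∞ φ → HasCompactSupport φ →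
    ContDiff ℝ ∞ ψ → HasCompactSupport ψ →
    Integrable (fun r : ℝ => (∫ x, A (r + x) * φ x) * ∫ y, A (r + y) * ψ y) ∧
      ∫ r : ℝ, (∫ x, A (r + x) * φ x) * (∫ y, A (r + y) * ψ y) = ∫ x, φ x * ψ x

/-! ### Hilbert–Schmidt integral operators on `L²(ℝ₊)` -/

section HilbertSchmidt

variable {k : ℝ → ℝ → ℝ}

theorem aestronglyMeasurable_kernel_integral
    (hk : MemLp (Function.uncurry k) 2 (halfLine.prod halfLine)) (f : L2) :
    AEStronglyMeasurable (fun x => ∫ y, k x y * f y ∂halfLine) halfLine := by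
  have h : AEStronglyMeasurable (fun p : ℝ × ℝ => k p.1 p.2 * f p.2)
      (halfLine.prod halfLine) :=
    hk.1.mul (Lp.aestronglyMeasurable f).comp_snd
  exact h.integral_prod_right'

theorem eLpNorm_kernel_integral_le
    (hk : MemLp (Function.uncurry k) 2 (halfLine.prod halfLine)) (f : L2) :
    eLpNorm (fun x => ∫ y, k x y * f y ∂halfLine) 2 halfLine ≤
      eLpNorm (Function.uncurry k) 2 (halfLine.prod halfLine) * eLpNorm f 2 halfLine := by
  have e2 : ∀ {α : Type} [MeasurableSpace α] (ν : Measure α) (g : α → ℝ),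
      eLpNorm g 2 ν = (∫⁻ x, ‖g x‖ₑ ^ (2 : ℝ) ∂ν) ^ (1 / 2 : ℝ) := by
    intro α _ ν g
    rw [eLpNorm_eq_lintegral_rpow_enorm_toReal (by norm_num) (by norm_num)]
    norm_num
  have hx : ∀ᵐ x ∂halfLine, AEStronglyMeasurable (fun y => k x y) halfLine :=
    hk.1.prodMk_left
  have hpt : ∀ᵐ x ∂halfLine, ‖∫ y, k x y * f y ∂halfLine‖ₑ ^ (2 : ℝ) ≤
      (∫⁻ y, ‖k x y‖ₑ ^ (2 : ℝ) ∂halfLine) * ∫⁻ y, ‖f y‖ₑ ^ (2 : ℝ) ∂halfLine := by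
    filter_upwards [hx] with x hx
    have h1 : ‖∫ y, k x y * f y ∂halfLine‖ₑ ≤ ∫⁻ y, ‖k x y‖ₑ * ‖f y‖ₑ ∂halfLine := by
      refine (enorm_integral_le_lintegral_enorm _).trans (le_of_eq ?_)
      simp only [enorm_mul]
    have h2 := ENNReal.lintegral_mul_le_Lp_mul_Lq halfLine
      (Real.HolderConjugate.two_two) hx.enorm (Lp.aestronglyMeasurable f).enorm
    have h3 := ENNReal.rpow_le_rpow (h1.trans h2) (z := 2) (by norm_num)
    refine h3.trans (le_of_eq ?_)
    rw [ENNReal.mul_rpow_of_nonneg _ _ (by norm_num), ← ENNReal.rpow_mul, ← ENNReal.rpow_mul]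
    norm_num
  rw [e2, e2, e2, ← ENNReal.mul_rpow_of_nonneg _ _ (by norm_num)]
  refine ENNReal.rpow_le_rpow ?_ (by norm_num)
  refine (lintegral_mono_ae hpt).trans ?_
  rw [lintegral_mul_const'' _ ?_]
  · rw [lintegral_prod _ (hk.1.enorm.pow_const _)]
    rfl
  · exact (hk.1.enorm.pow_const (2 : ℝ)).lintegral_prod_right'

theorem memLp_kernel_integral
    (hk : MemLp (Function.uncurry k) 2 (halfLine.prod halfLine)) (f : L2) :
    MemLp (fun x => ∫ y, k x y * f y ∂halfLine) 2 halfLine :=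
  ⟨aestronglyMeasurable_kernel_integral hk f,
    (eLpNorm_kernel_integral_le hk f).trans_lt
      (ENNReal.mul_lt_top hk.2 (Lp.memLp f).2)⟩

theorem ae_integrable_kernel_mul
    (hk : MemLp (Function.uncurry k) 2 (halfLine.prod halfLine)) (f : L2) :
    ∀ᵐ x ∂halfLine, Integrable (fun y => k x y * f y) halfLine := by
  have hsq : Integrable (fun p : ℝ × ℝ => (Function.uncurry k p) ^ 2)
      (halfLine.prod halfLine) := hk.integrable_sq
  filter_upwards [hsq.prod_right_ae, hk.1.prodMk_left] with x h1 h2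
  have h3 : MemLp (fun y => k x y) 2 halfLine := (memLp_two_iff_integrable_sq h2).2 h1
  exact h3.integrable_mul (Lp.memLp f)

/-- The Hilbert–Schmidt operator on `L²(ℝ₊)` with kernel `k`:
`(T f)(x) = ∫₀^∞ k(x, y) f(y) dy`. -/
def kernelOperator (k : ℝ → ℝ → ℝ)
    (hk : MemLp (Function.uncurry k) 2 (halfLine.prod halfLine)) : L2 →L[ℝ] L2 :=
  LinearMap.mkContinuous
    { toFun := fun f => (memLp_kernel_integral hk f).toLp _
      map_add' := by
        intro f g
        rw [← MemLp.toLp_add]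
        refine MemLp.toLp_congr _ _ ?_
        filter_upwards [ae_integrable_kernel_mul hk f, ae_integrable_kernel_mul hk g]
          with x hf hg
        rw [Pi.add_apply, ← integral_add hf hg]
        refine integral_congr_ae ?_
        filter_upwards [Lp.coeFn_add f g] with y hy
        rw [hy, Pi.add_apply, mul_add]
      map_smul' := by
        intro c f
        rw [RingHom.id_apply, ← MemLp.toLp_const_smul]
        refine MemLp.toLp_congr _ _ (ae_of_all _ fun x => ?_)
        rw [Pi.smul_apply, ← integral_smul]
        refine integral_congr_ae ?_
        filter_upwards [Lp.coeFn_smul c f] with y hy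
        rw [hy, Pi.smul_apply, smul_eq_mul, smul_eq_mul]
        ring }
    (eLpNorm (Function.uncurry k) 2 (halfLine.prod halfLine)).toReal
    (by
      intro f
      change ‖(memLp_kernel_integral hk f).toLp _‖ ≤ _
      rw [Lp.norm_toLp, Lp.norm_def, ← ENNReal.toReal_mul]
      exact ENNReal.toReal_mono (ENNReal.mul_lt_top hk.2 (Lp.memLp f).2).ne
        (eLpNorm_kernel_integral_le hk f))

theorem kernelOperator_apply_ae
    (hk : MemLp (Function.uncurry k) 2 (halfLine.prod halfLine)) (f : L2) :
    kernelOperator k hk f =ᵐ[halfLine] fun x => ∫ y in Ioi (0 : ℝ), k x y * f y :=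
  MemLp.coeFn_toLp (memLp_kernel_integral hk f)

end HilbertSchmidt

/-! ### Square integrability of the objects attached to `A` -/

section Integrability

variable {A : ℝ → ℝ}

theorem Admissible.exists_bound (hA : Admissible A) (s : ℝ) :
    ∃ C c : ℝ, 0 < C ∧ 0 < c ∧ ∀ x, 0 ≤ x → |A (x + s)| ≤ C * Real.exp (-c * x) := by
  obtain ⟨c, hc, hO⟩ := hA.decay
  obtain ⟨C, hC⟩ := hO.bound
  obtain ⟨N, hN⟩ := eventually_atTop.1 hC
  obtain ⟨M, hM⟩ := (isCompact_Icc (a := s) (b := max N s)).exists_bound_of_continuousOn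
    hA.smooth.continuous.continuousOn
  refine ⟨|C| * Real.exp (-c * s) + |M| * Real.exp (c * (max N s - s)) + 1, c,
    by positivity, hc, fun x hx => ?_⟩
  have p1 : 0 ≤ |C| * Real.exp (-c * s) * Real.exp (-c * x) := by positivity
  have p2 : 0 ≤ |M| * Real.exp (c * (max N s - s)) * Real.exp (-c * x) := by positivity
  have p3 : 0 < Real.exp (-c * x) := Real.exp_pos _
  rcases le_total N (x + s) with h | h
  · have h1 := hN _ h
    rw [Real.norm_eq_abs, Real.norm_eq_abs, Real.abs_exp] at h1
    have h2 : C * Real.exp (-c * (x + s)) ≤ |C| * Real.exp (-c * s) * Real.exp (-c * x) := by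
      rw [mul_assoc, ← Real.exp_add]
      have : -c * s + -c * x = -c * (x + s) := by ring
      rw [this]
      exact mul_le_mul_of_nonneg_right (le_abs_self C) (Real.exp_pos _).le
    nlinarith
  · have h1 := hM (x + s) ⟨by linarith, h.trans (le_max_left _ _)⟩
    rw [Real.norm_eq_abs] at h1
    have h2 : |M| ≤ |M| * Real.exp (c * (max N s - s)) * Real.exp (-c * x) := by
      rw [mul_assoc, ← Real.exp_add]
      refine le_mul_of_one_le_right (abs_nonneg M) (Real.one_le_exp ?_)
      have : x + s ≤ max N s := h.trans (le_max_left _ _)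
      nlinarith
    have := le_abs_self M
    nlinarith

theorem continuous_aKernel (hA : Admissible A) (s : ℝ) :
    Continuous fun p : ℝ × ℝ => aKernel A s p.1 p.2 := by
  have := hA.smooth.continuous
  unfold aKernel
  fun_prop

theorem stronglyMeasurable_kKernel (hA : Admissible A) (s : ℝ) :
    StronglyMeasurable (Function.uncurry (kKernel A s)) := by
  have hc := hA.smooth.continuous
  have h : StronglyMeasurable
      (fun p : (ℝ × ℝ) × ℝ => aKernel A s p.1.1 p.2 * aKernel A s p.1.2 p.2) := by
    unfold aKernel
    exact (by fun_prop : Continuous _).stronglyMeasurable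
  exact h.integral_prod_right' (ν := halfLine)

theorem Admissible.exists_kKernel_bound (hA : Admissible A) (s : ℝ) :
    ∃ C c : ℝ, 0 < C ∧ 0 < c ∧ ∀ x y, 0 ≤ x → 0 ≤ y →
      |kKernel A s x y| ≤ C * (Real.exp (-c * x) * Real.exp (-c * y)) := by
  obtain ⟨C, c, hC, hc, hb⟩ := hA.exists_bound s
  refine ⟨C ^ 2 * (∫ r in Ioi (0 : ℝ), Real.exp (-(2 * c) * r)) + 1, c, ?_, hc,
    fun x y hx hy => ?_⟩
  · have : 0 ≤ ∫ r in Ioi (0 : ℝ), Real.exp (-(2 * c) * r) :=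
      integral_nonneg fun r => (Real.exp_pos _).le
    positivity
  have hint : IntegrableOn (fun r : ℝ => C ^ 2 * (Real.exp (-c * x) * Real.exp (-c * y)) *
      Real.exp (-(2 * c) * r)) (Ioi 0) :=
    (exp_neg_integrableOn_Ioi 0 (by positivity : 0 < 2 * c)).const_mul _
  have h1 : |kKernel A s x y| ≤ ∫ r in Ioi (0 : ℝ),
      C ^ 2 * (Real.exp (-c * x) * Real.exp (-c * y)) * Real.exp (-(2 * c) * r) := by
    rw [← Real.norm_eq_abs]
    refine norm_integral_le_of_norm_le hint ?_
    filter_upwards [ae_restrict_mem measurableSet_Ioi] with r hr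
    have hr' : (0 : ℝ) ≤ r := (mem_Ioi.1 hr).le
    have b1 := hb (x + r) (by linarith)
    have b2 := hb (y + r) (by linarith)
    rw [Real.norm_eq_abs, abs_mul]
    refine (mul_le_mul b1 b2 (abs_nonneg _) (by positivity)).trans (le_of_eq ?_)
    have e : Real.exp (-c * (x + r)) * Real.exp (-c * (y + r)) =
        Real.exp (-c * x) * Real.exp (-c * y) * Real.exp (-(2 * c) * r) := by
      rw [← Real.exp_add, ← Real.exp_add, ← Real.exp_add]
      congr 1
      ring
    linear_combination C ^ 2 * e
  rw [integral_const_mul] at h1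
  have p : 0 < Real.exp (-c * x) * Real.exp (-c * y) := by positivity
  nlinarith

theorem memLp_exp {c : ℝ} (hc : 0 < c) :
    MemLp (fun x : ℝ => Real.exp (-c * x)) 2 halfLine := by
  refine (memLp_two_iff_integrable_sq (by fun_prop)).2 ?_
  have : (fun x : ℝ => Real.exp (-c * x) ^ 2) = fun x => Real.exp (-(2 * c) * x) := by
    funext x
    rw [← Real.exp_nat_mul]
    congr 1
    push_cast
    ring
  rw [this]
  exact exp_neg_integrableOn_Ioi 0 (by positivity : 0 < 2 * c)

theorem memLp_aKernel_zero (hA : Admissible A) (s : ℝ) :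
    MemLp (fun x => aKernel A s x 0) 2 halfLine := by
  obtain ⟨C, c, hC, hc, hb⟩ := hA.exists_bound s
  refine ((memLp_exp hc).const_mul C).mono' ?_ ?_
  · exact ((continuous_aKernel hA s).comp (by fun_prop :
      Continuous fun x : ℝ => (x, (0 : ℝ)))).aestronglyMeasurable
  · filter_upwards [ae_restrict_mem measurableSet_Ioi] with x hx
    simpa [aKernel] using hb x (mem_Ioi.1 hx).le

theorem memLp_kKernel_zero (hA : Admissible A) (s : ℝ) :
    MemLp (fun x => kKernel A s x 0) 2 halfLine := by
  obtain ⟨C, c, hC, hc, hb⟩ := hA.exists_kKernel_bound s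
  refine ((memLp_exp hc).const_mul C).mono' ?_ ?_
  · exact ((stronglyMeasurable_kKernel hA s).comp_measurable (by fun_prop :
      Measurable fun x : ℝ => (x, (0 : ℝ)))).aestronglyMeasurable
  · filter_upwards [ae_restrict_mem measurableSet_Ioi] with x hx
    simpa using hb x 0 (mem_Ioi.1 hx).le le_rfl

theorem memLp_kKernel (hA : Admissible A) (s : ℝ) :
    MemLp (Function.uncurry (kKernel A s)) 2 (halfLine.prod halfLine) := by
  obtain ⟨C, c, hC, hc, hb⟩ := hA.exists_kKernel_bound s
  have hprod : MemLp (fun p : ℝ × ℝ => Real.exp (-c * p.1) * Real.exp (-c * p.2)) 2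
      (halfLine.prod halfLine) := by
    refine (memLp_two_iff_integrable_sq (by fun_prop)).2 ?_
    have h := (memLp_exp hc).integrable_sq
    simpa only [mul_pow] using h.mul_prod h
  refine (hprod.const_mul C).mono' (stronglyMeasurable_kKernel hA s).aestronglyMeasurable ?_
  rw [Measure.prod_restrict]
  filter_upwards [ae_restrict_mem (measurableSet_Ioi.prod measurableSet_Ioi)] with p hp
  exact hb p.1 p.2 (mem_Ioi.1 hp.1).le (mem_Ioi.1 hp.2).le

end Integrability

/-! ### The Fredholm determinant and the functions `u₀`, `q₀` -/

/-- The `n`-th integral `∫_{ℝ₊ⁿ} det [k(xᵢ, xⱼ)] dx₁ ⋯ dxₙ` (it equals `1` for `n = 0`). -/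
def fredholmCoeff (k : ℝ → ℝ → ℝ) (n : ℕ) : ℝ :=
  ∫ x in Set.univ.pi (fun _ : Fin n => Ioi (0 : ℝ)),
    (Matrix.of fun i j : Fin n => k (x i) (x j)).det

/-- The Fredholm determinant `Det(I - k)` on `L²(ℝ₊)`, given by
`1 + ∑_{n ≥ 1} (-1)ⁿ/n! ∫_{ℝ₊ⁿ} det [k(xᵢ, xⱼ)] dx₁ ⋯ dxₙ`. -/
def fredholmDet (k : ℝ → ℝ → ℝ) : ℝ :=
  1 + ∑' n : ℕ, (-1) ^ (n + 1) / (Nat.factorial (n + 1) : ℝ) * fredholmCoeff k (n + 1)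

/-- The integrals and the series in the Fredholm determinant converge absolutely. -/
def FredholmSeriesConverges (k : ℝ → ℝ → ℝ) : Prop :=
  (∀ n : ℕ, IntegrableOn
    (fun x : Fin n → ℝ => (Matrix.of fun i j : Fin n => k (x i) (x j)).det)
    (Set.univ.pi fun _ : Fin n => Ioi (0 : ℝ))) ∧
  Summable fun n : ℕ => (-1) ^ (n + 1) / (Nat.factorial (n + 1) : ℝ) * fredholmCoeff k (n + 1)

/-- The operator `K_s` on `L²(ℝ₊)`. -/
def kOp {A : ℝ → ℝ} (hA : Admissible A) (s : ℝ) : L2 →L[ℝ] L2 :=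
  kernelOperator (kKernel A s) (memLp_kKernel hA s)

/-- `(I - K_s)⁻¹` in the algebra of bounded operators on `L²(ℝ₊)`. -/
def resolvent {A : ℝ → ℝ} (hA : Admissible A) (s : ℝ) : L2 →L[ℝ] L2 :=
  Ring.inverse (1 - kOp hA s)

/-- The function `A_s|δ⟩ : x ↦ A_s(x, 0) = A(x + s)` in `L²(ℝ₊)`. -/
def aVec {A : ℝ → ℝ} (hA : Admissible A) (s : ℝ) : L2 :=
  (memLp_aKernel_zero hA s).toLp (fun x => aKernel A s x 0)

/-- The function `K_s|δ⟩ : x ↦ K_s(x, 0)` in `L²(ℝ₊)`. -/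
def kVec {A : ℝ → ℝ} (hA : Admissible A) (s : ℝ) : L2 :=
  (memLp_kKernel_zero hA s).toLp (fun x => kKernel A s x 0)

/-- `u₀(s) = ⟨δ|A_s (I - K_s)⁻¹ A_s|δ⟩ = ∬ A(s + y) (I - K_s)⁻¹(y, z) A(z + s) dy dz`. -/
def u₀ {A : ℝ → ℝ} (hA : Admissible A) (s : ℝ) : ℝ :=
  inner ℝ (aVec hA s) (resolvent hA s (aVec hA s))

/-- `q₀(s) = ⟨δ|A_s (I - K_s)⁻¹|δ⟩ = ∫ A(s + y) (I - K_s)⁻¹(y, 0) dy`. Since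
`(I - K_s)⁻¹ = I + (I - K_s)⁻¹ K_s`, the distributional kernel is
`(I - K_s)⁻¹(y, 0) = δ(y) + ((I - K_s)⁻¹ K_s(·, 0))(y)`; the mass at `y = 0` contributes `A(s)`. -/
def q₀ {A : ℝ → ℝ} (hA : Admissible A) (s : ℝ) : ℝ :=
  A s + inner ℝ (aVec hA s) (resolvent hA s (kVec hA s))

end TauRep

end

/-! Write `a_r = A(· + r)`. In `L²(ℝ₊)` the Hankel operator `A_s` is self-adjoint and
`K_s = A_s² = ∫_s^∞ a_r ⊗ a_r dr`, so `K_s` is compact and commutes with `A_s`, and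
`∂_s K_s = -a_s ⊗ a_s`.

*Invertibility.* Orthogonality of `A` gives `⟨f, K_s f⟩ ≤ ‖f‖²` for every `s`. If `K_s f = f`, the
non-increasing function `r ↦ ⟨f, K_r f⟩` attains this bound at all `r ≤ s`, so its derivative
`-⟨a_r, f⟩²` vanishes there. This vanishing yields `⟨a_r, A_{s-t} A_s f⟩ = ⟨a_{r+t}, f⟩` for
`t ≥ 0`, and translates of a nonzero function that vanishes on a left half-line are linearly
independent. So if `f ≠ 0`, the vectors `A_{s-t} A_s f`, `0 ≤ t ≤ 1`, are infinitely many linearly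
independent solutions of `K_{s-1} g = g`, which contradicts compactness.

*First derivative.* Fredholm's numerator series `E` satisfies `(1 - K_s) E = Det(1 - K_s) a_s`,
and differentiating the Fredholm series term by term, with Hadamard's inequality as majorant, gives
`∂_s Det(1 - K_s) = ⟨a_s, E⟩ = Det(1 - K_s) u₀(s)`. As the determinant tends to `1` at `+∞`, this
differential equation integrates to the exponential formula, and positivity follows.

*Second derivative.* Let `k_s = K_s(·, 0) = A_s a_s`. Then
`u₀(s) = ‖a_s‖² + ⟨k_s, (1 - K_s)⁻¹ k_s⟩`, where `∂_s ‖a_s‖² = -A(s)²` and `∂_s k_s = -A(s) a_s`;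
the product rule turns the right-hand side into a perfect square.
-/

noncomputable section

namespace TauRep

theorem integral_Ioi_comp_add_right {E : Type*} [NormedAddCommGroup E] [NormedSpace ℝ E]
    (F : ℝ → E) (a s : ℝ) : ∫ r in Ioi a, F (r + s) = ∫ r in Ioi (a + s), F r := by
  rw [← (measurePreserving_add_right volume s).setIntegral_preimage_emb
    (measurableEmbedding_addRight s) F (Ioi (a + s)), preimage_add_const_Ioi, add_sub_cancel_right]

theorem hasDerivAt_integral_Ioi {E : Type*} [NormedAddCommGroup E] [NormedSpace ℝ E]
    [CompleteSpace E] {F : ℝ → E} (hF : Continuous F) (hi : ∀ s, IntegrableOn F (Ioi s)) (s : ℝ) :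
    HasDerivAt (fun t => ∫ r in Ioi t, F r) (-F s) s := by
  have h : HasDerivAt (fun t => (∫ r in Ioi s, F r) - ∫ r in s..t, F r) (-F s) s :=
    (intervalIntegral.integral_hasDerivAt_right (hF.intervalIntegrable s s)
      (hF.stronglyMeasurableAtFilter _ _) hF.continuousAt).const_sub _
  refine h.congr_of_eventuallyEq (Eventually.of_forall fun t => ?_)
  exact (sub_eq_of_eq_add' (intervalIntegral.integral_interval_add_Ioi (hi s) (hi t)).symm).symm

theorem eq_exp_neg_integral_Ioi_of_hasDerivAt {D u : ℝ → ℝ} (hu : Continuous u)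
    (hi : ∀ s, IntegrableOn u (Ioi s)) (hD : ∀ s, HasDerivAt D (D s * u s) s)
    (hlim : Tendsto D atTop (nhds 1)) (s : ℝ) : D s = Real.exp (-∫ t in Ioi s, u t) := by
  let Φ : ℝ → ℝ := fun s => D s * Real.exp (∫ t in Ioi s, u t)
  have hΦ : ∀ s, HasDerivAt Φ 0 s := fun s =>
    ((hD s).mul (hasDerivAt_integral_Ioi hu hi s).exp).congr_deriv (by ring)
  have hconst : ∀ t, Φ t = Φ s := fun t =>
    is_const_of_deriv_eq_zero (fun x => (hΦ x).differentiableAt) (fun x => (hΦ x).deriv) t s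
  have hΦlim : Tendsto Φ atTop (nhds 1) := by
    simpa using hlim.mul (tendsto_integral_Ioi_zero (f := u) tendsto_id).rexp
  have hΦs : Φ s = 1 :=
    tendsto_nhds_unique (tendsto_const_nhds.congr fun t => (hconst t).symm) hΦlim
  rw [Real.exp_neg]
  exact eq_inv_of_mul_eq_one_left hΦs

theorem integral_mem_of_isClosed {E α : Type*} [NormedAddCommGroup E] [NormedSpace ℝ E]
    [CompleteSpace E] [MeasurableSpace α] {μ : Measure α} {M : Submodule ℝ E}
    (hM : IsClosed (M : Set E)) {f : α → E} (hf : Integrable f μ) (hfM : ∀ x, f x ∈ M) :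
    ∫ x, f x ∂μ ∈ M := by
  have := hM
  have h := ContinuousLinearMap.integral_comp_comm (𝕜 := ℝ) M.mkQL hf
  rw [← Submodule.Quotient.mk_eq_zero, ← Submodule.mkQ_apply, ← Submodule.mkQL_apply, ← h]
  refine integral_eq_zero_of_ae (ae_of_all _ fun x => ?_)
  simpa using hfM x

theorem linearIndependent_translates {K E : Type*} [DivisionRing K] [AddCommGroup E] [Module K E]
    {φ : ℝ → E} (hφ : φ ≠ 0) {b : ℝ} (hb : ∀ x ≤ b, φ x = 0) :
    LinearIndependent K fun t x : ℝ => φ (x + t) := by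
  classical
  rw [linearIndependent_iff']
  intro S g hsum
  by_contra! hne
  obtain ⟨t₀, ht₀, hmax⟩ := (S.filter (g · ≠ 0)).exists_max_image id
    (hne.imp fun t ht => Finset.mem_filter.2 ht)
  have hbdd : BddBelow (Function.support φ) :=
    ⟨b, fun x hx => le_of_lt (not_le.1 fun hxb => hx (hb x hxb))⟩
  -- near the left end of the support of `φ` only the largest translation `t₀` contributes
  have hleft : ∃ᶠ x in nhds (sInf (Function.support φ)), φ x ≠ 0 :=
    mem_closure_iff_frequently.1 (csInf_mem_closure (Function.support_nonempty_iff.2 hφ) hbdd)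
  have hgap : ∀ᶠ x in nhds (sInf (Function.support φ)), ∀ t ∈ S, t < t₀ →
      x - t₀ + t < sInf (Function.support φ) := by
    refine (Finset.eventually_all S).2 fun t _ => ?_
    by_cases ht : t < t₀
    · filter_upwards [Iio_mem_nhds (lt_add_of_pos_right _ (sub_pos.2 ht))] with x hx _
      linarith [mem_Iio.1 hx]
    · exact Eventually.of_forall fun x hx => absurd hx ht
  obtain ⟨x, hx, hxS⟩ := (hleft.and_eventually hgap).exists
  have hterm : ∀ t ∈ S, t ≠ t₀ → g t • φ (x - t₀ + t) = 0 := fun t ht hne => by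
    by_cases hgt : g t = 0
    · rw [hgt, zero_smul]
    · rw [Function.notMem_support.1 (notMem_of_lt_csInf (hxS t ht
        ((hmax t (Finset.mem_filter.2 ⟨ht, hgt⟩)).lt_of_ne hne)) hbdd), smul_zero]
  have hx₀ := congrFun hsum (x - t₀)
  simp only [Finset.sum_apply, Pi.smul_apply, Pi.zero_apply] at hx₀
  rw [Finset.sum_eq_single_of_mem t₀ (Finset.mem_filter.1 ht₀).1 hterm, sub_add_cancel] at hx₀
  exact smul_ne_zero (Finset.mem_filter.1 ht₀).2 hx hx₀

section Lp

variable {α : Type*} [MeasurableSpace α] {μ : Measure α}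

theorem inner_eq_integral (f g : Lp ℝ 2 μ) : inner ℝ f g = ∫ x, f x * g x ∂μ := by
  simp only [L2.inner_def, RCLike.inner_apply, conj_trivial, mul_comm]

theorem inner_toLp {g : α → ℝ} (hg : MemLp g 2 μ) (f : Lp ℝ 2 μ) :
    inner ℝ (hg.toLp g) f = ∫ x, g x * f x ∂μ := by
  rw [inner_eq_integral]
  refine integral_congr_ae ?_
  filter_upwards [hg.coeFn_toLp] with x hx
  rw [hx]

theorem inner_toLp_toLp {g h : α → ℝ} (hg : MemLp g 2 μ) (hh : MemLp h 2 μ) :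
    inner ℝ (hg.toLp g) (hh.toLp h) = ∫ x, g x * h x ∂μ := by
  rw [inner_toLp]
  refine integral_congr_ae ?_
  filter_upwards [hh.coeFn_toLp] with x hx
  rw [hx]

theorem tendsto_toLp_of_dominated {E ι : Type*} [NormedAddCommGroup E] {p : ℝ≥0∞} [Fact (1 ≤ p)]
    (hp : p ≠ ⊤) {l : Filter ι} [l.IsCountablyGenerated] {F : ι → α → E} {f : α → E}
    (hF : ∀ i, MemLp (F i) p μ) (hf : MemLp f p μ) {b : α → ℝ} (hb : MemLp b p μ)
    (hFb : ∀ᶠ i in l, ∀ᵐ x ∂μ, ‖F i x‖ ≤ b x)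
    (hlim : ∀ᵐ x ∂μ, Tendsto (F · x) l (nhds (f x))) :
    Tendsto (fun i => (hF i).toLp (F i)) l (nhds (hf.toLp f)) := by
  have hp0 : p ≠ 0 := (one_pos.trans_le Fact.out).ne'
  have hpos : 0 < p.toReal := ENNReal.toReal_pos hp0 hp
  have hbf : MemLp (fun x => b x + ‖f x‖) p μ := hb.add hf.norm
  rw [Lp.tendsto_Lp_iff_tendsto_eLpNorm'']
  have hpow : Tendsto (fun i => ∫⁻ x, ‖(F i - f) x‖ₑ ^ p.toReal ∂μ) l
      (nhds (∫⁻ _, 0 ∂μ)) := by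
    refine tendsto_lintegral_filter_of_dominated_convergence'
      (fun x => ‖b x + ‖f x‖‖ₑ ^ p.toReal)
      (Eventually.of_forall fun i => ((hF i).sub hf).1.enorm.pow_const _) ?_
      ((eLpNorm_lt_top_iff_lintegral_rpow_enorm_lt_top hp0 hp).1 hbf.2).ne ?_
    · filter_upwards [hFb] with i hi
      filter_upwards [hi] with x hx
      refine ENNReal.rpow_le_rpow (enorm_le_iff_norm_le.2 ?_) hpos.le
      exact (norm_sub_le _ _).trans ((by gcongr : _ ≤ b x + ‖f x‖).trans (le_abs_self _))
    · filter_upwards [hlim] with x hx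
      simpa [ENNReal.zero_rpow_of_pos hpos] using
        ((hx.sub_const (f x)).enorm).ennrpow_const p.toReal
  simpa [eLpNorm_eq_lintegral_rpow_enorm_toReal hp0 hp, ENNReal.zero_rpow_of_pos (inv_pos.2 hpos)]
    using hpow.ennrpow_const (1 / p.toReal)

end Lp

section TestFunctions

variable {E : Type*} [NormedAddCommGroup E] [NormedSpace ℝ E] [MeasurableSpace E]

/-- The smooth functions with compact support in `U`, as elements of `L²(U)`. -/
def testFunctions (μ : Measure E) (U : Set E) : Submodule ℝ (Lp ℝ 2 (μ.restrict U)) where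
  carrier := {f | ∃ ψ : E → ℝ, ContDiff ℝ ∞ ψ ∧ HasCompactSupport ψ ∧ tsupport ψ ⊆ U ∧
    f =ᵐ[μ.restrict U] ψ}
  add_mem' := by
    rintro f g ⟨φ, hφ, hφc, hφU, hf⟩ ⟨ψ, hψ, hψc, hψU, hg⟩
    exact ⟨φ + ψ, hφ.add hψ, hφc.add hψc, (tsupport_add φ ψ).trans (union_subset hφU hψU),
      (Lp.coeFn_add f g).trans (hf.add hg)⟩
  zero_mem' := ⟨0, contDiff_const, HasCompactSupport.zero, by simp [tsupport],
    Lp.coeFn_zero ℝ 2 _⟩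
  smul_mem' := by
    rintro c f ⟨φ, hφ, hφc, hφU, hf⟩
    exact ⟨fun x => c • φ x, hφ.const_smul c, hφc.smul_left (f := fun _ => c),
      (tsupport_smul_subset_right (fun _ => c) φ).trans hφU,
      (Lp.coeFn_smul c f).trans (hf.const_smul c)⟩

theorem dense_testFunctions [FiniteDimensional ℝ E] [BorelSpace E] (μ : Measure E)
    [IsLocallyFiniteMeasure μ] {U : Set E} (hU : IsOpen U) :
    Dense (testFunctions μ U : Set (Lp ℝ 2 (μ.restrict U))) := by
  have := FiniteDimensional.proper ℝ E
  rw [Submodule.dense_iff_topologicalClosure_eq_top, Submodule.topologicalClosure_eq_top_iff,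
    Submodule.eq_bot_iff]
  intro f hf
  have hloc : LocallyIntegrableOn f U μ :=
    locallyIntegrableOn_of_locallyIntegrable_restrict
      ((Lp.memLp f).locallyIntegrable one_le_two)
  have hzero := hU.ae_eq_zero_of_integral_contDiff_smul_eq_zero hloc fun ψ hψ hψc hψU => by
    have hmem : MemLp ψ 2 (μ.restrict U) := hψ.continuous.memLp_of_hasCompactSupport hψc
    have h := hf (hmem.toLp ψ) ⟨ψ, hψ, hψc, hψU, hmem.coeFn_toLp⟩
    rw [inner_toLp] at h
    rwa [← setIntegral_eq_integral_of_forall_compl_eq_zero (s := U)]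
    intro x hx
    rw [image_eq_zero_of_notMem_tsupport fun h => hx (hψU h), zero_smul]
  refine Lp.ext ?_
  filter_upwards [ae_restrict_of_ae hzero, ae_restrict_mem hU.measurableSet,
    Lp.coeFn_zero ℝ 2 (μ.restrict U)] with x h1 h2 h3
  rw [h1 h2, h3, Pi.zero_apply]

end TestFunctions

section Decay

variable {A : ℝ → ℝ}

theorem memLp_two_Ioi_of_isBigO_exp_neg {E : Type*} [NormedAddCommGroup E] {F : ℝ → E}
    (hF : Continuous F) {c : ℝ} (hc : 0 < c) (hO : F =O[atTop] fun x => Real.exp (-c * x))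
    (s : ℝ) : MemLp F 2 (volume.restrict (Ioi s)) := by
  refine (memLp_two_iff_integrable_sq_norm hF.aestronglyMeasurable).2 ?_
  refine integrable_of_isBigO_exp_neg (b := 2 * c) (by positivity) (by fun_prop) ?_
  refine (hO.norm_left.pow 2).congr_right fun x => ?_
  rw [← Real.exp_nat_mul]
  congr 1
  push_cast
  ring

theorem Admissible.exists_uniform_bound (hA : Admissible A) (S : ℝ) :
    ∃ C c : ℝ, 0 < C ∧ 0 < c ∧ ∀ s, S ≤ s → ∀ x, 0 ≤ x →
      |A (x + s)| ≤ C * Real.exp (-c * (s - S)) * Real.exp (-c * x) := by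
  obtain ⟨C, c, hC, hc, hb⟩ := hA.exists_bound S
  refine ⟨C, c, hC, hc, fun s hs x hx => ?_⟩
  have h := hb (x + (s - S)) (by linarith)
  rwa [add_assoc, sub_add_cancel, mul_add, add_comm (-c * x), Real.exp_add, ← mul_assoc] at h

theorem Admissible.exists_norm_aVec_le (hA : Admissible A) (S : ℝ) :
    ∃ C c : ℝ, 0 < C ∧ 0 < c ∧ ∀ s, S ≤ s →
      |A s| ≤ C * Real.exp (-c * (s - S)) ∧ ‖aVec hA s‖ ≤ C * Real.exp (-c * (s - S)) := by
  obtain ⟨C, c, hC, hc, hb⟩ := hA.exists_uniform_bound S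
  let e : L2 := (memLp_exp hc).toLp _
  have hCe : C ≤ C * (1 + ‖e‖) := le_mul_of_one_le_right hC.le (by simp)
  refine ⟨C * (1 + ‖e‖), c, by positivity, hc, fun s hs => ⟨?_, ?_⟩⟩
  · have h := hb s hs 0 le_rfl
    rw [zero_add, mul_zero, Real.exp_zero, mul_one] at h
    exact h.trans (by gcongr)
  · have h : ‖aVec hA s‖ ≤ C * Real.exp (-c * (s - S)) * ‖e‖ := by
      refine Lp.norm_le_mul_norm_of_ae_le_mul ?_
      filter_upwards [(memLp_aKernel_zero hA s).coeFn_toLp, (memLp_exp hc).coeFn_toLp,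
        ae_restrict_mem measurableSet_Ioi] with x ha he hx
      rw [aVec, ha, he, Real.norm_eq_abs, Real.norm_eq_abs, Real.abs_exp, aKernel, add_zero]
      exact hb s hs x (le_of_lt hx)
    refine h.trans (le_of_le_of_eq ?_ (mul_right_comm _ _ _))
    gcongr
    simp

theorem continuous_aVec (hA : Admissible A) : Continuous (aVec hA) := by
  refine continuous_iff_continuousAt.2 fun s => ?_
  obtain ⟨C, c, hC, hc, hb⟩ := hA.exists_uniform_bound (s - 1)
  refine tendsto_toLp_of_dominated ENNReal.ofNat_ne_top _ _ ((memLp_exp hc).const_mul C) ?_ ?_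
  · filter_upwards [Ioi_mem_nhds (sub_one_lt s)] with t ht
    filter_upwards [ae_restrict_mem measurableSet_Ioi] with x hx
    rw [Real.norm_eq_abs, aKernel, add_zero]
    refine (hb t (le_of_lt ht) x (le_of_lt hx)).trans ?_
    gcongr
    refine mul_le_of_le_one_right hC.le (Real.exp_le_one_iff.2 ?_)
    exact mul_nonpos_of_nonpos_of_nonneg (neg_nonpos.2 hc.le) (sub_nonneg.2 (le_of_lt ht))
  · refine ae_of_all _ fun x => Continuous.tendsto ?_ s
    have := hA.smooth.continuous
    unfold aKernel
    fun_prop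

theorem memLp_aVec (hA : Admissible A) (s : ℝ) :
    MemLp (aVec hA) 2 (volume.restrict (Ioi s)) := by
  obtain ⟨C, c, _, hc, hb⟩ := hA.exists_norm_aVec_le 0
  refine memLp_two_Ioi_of_isBigO_exp_neg (continuous_aVec hA) hc (.of_bound C ?_) s
  filter_upwards [eventually_ge_atTop 0] with t ht
  simpa using (hb t ht).2

theorem Admissible.memLp_comp_add_right (hA : Admissible A) (x s : ℝ) :
    MemLp (fun r => A (r + x)) 2 (volume.restrict (Ioi s)) := by
  obtain ⟨c, hc, hO⟩ := hA.decay
  have h := (memLp_two_Ioi_of_isBigO_exp_neg hA.smooth.continuous hc hO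
    (s + x)).comp_measurePreserving
      ((measurePreserving_add_right volume x).restrict_preimage measurableSet_Ioi)
  rwa [preimage_add_const_Ioi, add_sub_cancel_right] at h

theorem Admissible.memLp (hA : Admissible A) (s : ℝ) :
    MemLp A 2 (volume.restrict (Ioi s)) := by
  simpa using hA.memLp_comp_add_right 0 s

end Decay

section Kernel

variable {k : ℝ → ℝ → ℝ}

theorem integrable_kernel_mul_mul (hk : MemLp (Function.uncurry k) 2 (halfLine.prod halfLine))
    {f g : ℝ → ℝ} (hf : MemLp f 2 halfLine) (hg : MemLp g 2 halfLine) :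
    Integrable (fun p : ℝ × ℝ => k p.1 p.2 * (f p.1 * g p.2)) (halfLine.prod halfLine) := by
  refine MemLp.integrable_mul (p := 2) (q := 2) hk ?_
  refine (memLp_two_iff_integrable_sq (hf.1.comp_fst.mul hg.1.comp_snd)).2 ?_
  simpa only [Pi.mul_apply, mul_pow] using hf.integrable_sq.mul_prod hg.integrable_sq

theorem inner_kernelOperator (hk : MemLp (Function.uncurry k) 2 (halfLine.prod halfLine))
    (f g : L2) :
    inner ℝ f (kernelOperator k hk g) =
      ∫ p, k p.1 p.2 * (f p.1 * g p.2) ∂(halfLine.prod halfLine) := by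
  rw [integral_prod _ (integrable_kernel_mul_mul hk (Lp.memLp f) (Lp.memLp g)), inner_eq_integral]
  refine integral_congr_ae ?_
  filter_upwards [kernelOperator_apply_ae hk g] with x hx
  rw [hx, ← integral_const_mul]
  simp only [mul_left_comm]

theorem isSelfAdjoint_kernelOperator
    (hk : MemLp (Function.uncurry k) 2 (halfLine.prod halfLine)) (hsymm : ∀ x y, k x y = k y x) :
    IsSelfAdjoint (kernelOperator k hk) := by
  refine ContinuousLinearMap.isSelfAdjoint_iff_isSymmetric.2 fun f g => ?_
  change inner ℝ (kernelOperator k hk f) g = inner ℝ f (kernelOperator k hk g)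
  rw [real_inner_comm, inner_kernelOperator, inner_kernelOperator, ← integral_prod_swap]
  simp only [Prod.fst_swap, Prod.snd_swap, hsymm, mul_comm]

end Kernel

theorem isCompactOperator_rankOne {𝕜 E F : Type*} [RCLike 𝕜] [NormedAddCommGroup E]
    [InnerProductSpace 𝕜 E] [NormedAddCommGroup F] [NormedSpace 𝕜 F] (x : F) (y : E) :
    IsCompactOperator (InnerProductSpace.rankOne 𝕜 x y) :=
  ((isCompactOperator_id (E := 𝕜)).comp_clm (innerSL 𝕜 y)).clm_comp
    (ContinuousLinearMap.toSpanSingleton 𝕜 x)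

section HankelOperator

variable {A : ℝ → ℝ}

theorem memLp_aKernel (hA : Admissible A) (s : ℝ) :
    MemLp (Function.uncurry (aKernel A s)) 2 (halfLine.prod halfLine) := by
  obtain ⟨C, c, _, hc, hb⟩ := hA.exists_bound s
  have hprod : MemLp (fun p : ℝ × ℝ => Real.exp (-c * p.1) * Real.exp (-c * p.2)) 2
      (halfLine.prod halfLine) := by
    refine (memLp_two_iff_integrable_sq (by fun_prop)).2 ?_
    have h := (memLp_exp hc).integrable_sq
    simpa only [mul_pow] using h.mul_prod h
  refine (hprod.const_mul C).mono' (continuous_aKernel hA s).aestronglyMeasurable ?_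
  rw [Measure.prod_restrict]
  filter_upwards [ae_restrict_mem (measurableSet_Ioi.prod measurableSet_Ioi)] with p hp
  rw [← Real.exp_add, ← mul_add]
  exact hb (p.1 + p.2) (add_pos hp.1 hp.2).le

/-- The operator `A_s` on `L²(ℝ₊)`, whose kernel `A(x + y + s)` is a Hankel kernel; it is a
square root of `K_s`. -/
def aOp (hA : Admissible A) (s : ℝ) : L2 →L[ℝ] L2 :=
  kernelOperator (aKernel A s) (memLp_aKernel hA s)

theorem isSelfAdjoint_aOp (hA : Admissible A) (s : ℝ) : IsSelfAdjoint (aOp hA s) :=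
  isSelfAdjoint_kernelOperator _ fun x y => by rw [aKernel, aKernel, add_comm x y]

theorem inner_aOp_comm (hA : Admissible A) (s : ℝ) (f g : L2) :
    inner ℝ (aOp hA s f) g = inner ℝ f (aOp hA s g) :=
  (isSelfAdjoint_aOp hA s).isSymmetric f g

theorem inner_aVec (hA : Admissible A) (s : ℝ) (f : L2) :
    inner ℝ (aVec hA s) f = ∫ x in Ioi (0 : ℝ), A (x + s) * f x := by
  simp only [aVec, inner_toLp, aKernel, add_zero]

theorem inner_aVec_aVec (hA : Admissible A) (s t : ℝ) :
    inner ℝ (aVec hA s) (aVec hA t) = ∫ r in Ioi (0 : ℝ), A (r + s) * A (r + t) := by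
  simp only [aVec, inner_toLp_toLp, aKernel, add_zero]

theorem kKernel_eq_inner (hA : Admissible A) (s x y : ℝ) :
    kKernel A s x y = inner ℝ (aVec hA (x + s)) (aVec hA (y + s)) := by
  simp only [inner_aVec_aVec, kKernel, aKernel, add_left_comm, add_comm x, add_comm y, add_assoc]

theorem isSelfAdjoint_kOp (hA : Admissible A) (s : ℝ) : IsSelfAdjoint (kOp hA s) :=
  isSelfAdjoint_kernelOperator _ fun x y => by simp only [kKernel, mul_comm]

theorem kKernel_eq_integral_Ioi (A : ℝ → ℝ) (s x y : ℝ) :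
    kKernel A s x y = ∫ r in Ioi s, A (r + x) * A (r + y) := by
  have h := integral_Ioi_comp_add_right (fun r => A (r + x) * A (r + y)) 0 s
  rw [zero_add] at h
  simp only [← h, kKernel, aKernel, add_right_comm _ _ s, add_comm x, add_comm y]

theorem aOp_apply_ae (hA : Admissible A) (s : ℝ) (f : L2) :
    aOp hA s f =ᵐ[halfLine] fun r => inner ℝ (aVec hA (r + s)) f := by
  filter_upwards [kernelOperator_apply_ae (memLp_aKernel hA s) f] with r hr
  simp only [aOp, hr, inner_aVec, aKernel, add_left_comm r, add_assoc]

theorem inner_aOp (hA : Admissible A) (s : ℝ) (f g : L2) :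
    inner ℝ f (aOp hA s g) = ∫ y in Ioi (0 : ℝ), inner ℝ (aVec hA (y + s)) f * g y := by
  rw [← inner_aOp_comm, inner_eq_integral]
  refine integral_congr_ae ?_
  filter_upwards [aOp_apply_ae hA s f] with y hy
  rw [hy]

theorem aOp_aOp (hA : Admissible A) (s : ℝ) (f : L2) :
    aOp hA s (aOp hA s f) = kOp hA s f := by
  refine Lp.ext ?_
  filter_upwards [aOp_apply_ae hA s (aOp hA s f), kernelOperator_apply_ae (memLp_kKernel hA s) f]
    with x h1 h2
  simp only [h1, kOp, h2, inner_aOp, kKernel_eq_inner hA, real_inner_comm]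

theorem aOp_aVec (hA : Admissible A) (s : ℝ) : aOp hA s (aVec hA s) = kVec hA s := by
  refine Lp.ext ?_
  filter_upwards [aOp_apply_ae hA s (aVec hA s), (memLp_kKernel_zero hA s).coeFn_toLp] with x h1 h2
  rw [h1, kVec, h2, kKernel_eq_inner hA, zero_add]

theorem integral_inner_aVec_mul (hA : Admissible A) (s : ℝ) (f g : L2) :
    ∫ r in Ioi s, inner ℝ (aVec hA r) f * inner ℝ (aVec hA r) g = inner ℝ f (kOp hA s g) := by
  have h := integral_Ioi_comp_add_right
    (fun r => inner ℝ (aVec hA r) f * inner ℝ (aVec hA r) g) 0 s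
  rw [← aOp_aOp, inner_aOp, ← zero_add s, ← h]
  refine integral_congr_ae ?_
  filter_upwards [aOp_apply_ae hA s g] with r hr
  rw [zero_add, hr]

theorem continuous_rankOne_aVec (hA : Admissible A) :
    Continuous fun r => InnerProductSpace.rankOne ℝ (aVec hA r) (aVec hA r) :=
  ((InnerProductSpace.rankOne (E := L2) (F := L2) ℝ).continuous.comp
    (continuous_aVec hA)).clm_apply (continuous_aVec hA)

theorem integrableOn_rankOne_aVec (hA : Admissible A) (s : ℝ) :
    IntegrableOn (fun r => InnerProductSpace.rankOne ℝ (aVec hA r) (aVec hA r)) (Ioi s) := by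
  refine ((memLp_aVec hA s).norm.integrable_mul (memLp_aVec hA s).norm).mono' ?_
    (ae_of_all _ fun r => (InnerProductSpace.norm_rankOne _ _).le)
  exact (continuous_rankOne_aVec hA).aestronglyMeasurable

theorem kOp_eq_integral (hA : Admissible A) (s : ℝ) :
    kOp hA s = ∫ r in Ioi s, InnerProductSpace.rankOne ℝ (aVec hA r) (aVec hA r) := by
  have hint := integrableOn_rankOne_aVec hA s
  refine ContinuousLinearMap.ext fun g => ext_inner_left ℝ fun f => ?_
  rw [← integral_inner_aVec_mul, ContinuousLinearMap.integral_apply hint,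
    ← integral_inner (hint.apply_continuousLinearMap g)]
  simp only [InnerProductSpace.rankOne_apply, inner_smul_right, real_inner_comm f, mul_comm]

theorem isCompactOperator_kOp (hA : Admissible A) (s : ℝ) : IsCompactOperator (kOp hA s) := by
  rw [kOp_eq_integral]
  refine integral_mem_of_isClosed (M := compactOperator (RingHom.id ℝ) L2 L2)
    isClosed_setOfPred_isCompactOperator (integrableOn_rankOne_aVec hA s) fun r => ?_
  exact isCompactOperator_rankOne _ _

theorem hasDerivAt_kOp (hA : Admissible A) (s : ℝ) :
    HasDerivAt (kOp hA) (-InnerProductSpace.rankOne ℝ (aVec hA s) (aVec hA s)) s := by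
  rw [funext (kOp_eq_integral hA)]
  exact hasDerivAt_integral_Ioi (continuous_rankOne_aVec hA) (integrableOn_rankOne_aVec hA) s

theorem integrableOn_smul_aVec (hA : Admissible A) (s : ℝ) :
    IntegrableOn (fun r => A r • aVec hA r) (Ioi s) :=
  memLp_one_iff_integrable.1 ((memLp_aVec hA s).smul (hA.memLp s))

theorem kVec_eq_integral (hA : Admissible A) (s : ℝ) :
    kVec hA s = ∫ r in Ioi s, A r • aVec hA r := by
  refine ext_inner_left ℝ fun f => ?_
  have h := integral_Ioi_comp_add_right (fun r => inner ℝ f (A r • aVec hA r)) 0 s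
  rw [← integral_inner (integrableOn_smul_aVec hA s), ← aOp_aVec, ← inner_aOp_comm,
    real_inner_comm, inner_aVec, ← zero_add s, ← h]
  refine integral_congr_ae ?_
  filter_upwards [aOp_apply_ae hA s f] with r hr
  rw [zero_add, hr, inner_smul_right, real_inner_comm f]

theorem hasDerivAt_kVec (hA : Admissible A) (s : ℝ) :
    HasDerivAt (kVec hA) (-(A s • aVec hA s)) s := by
  rw [funext (kVec_eq_integral hA)]
  exact hasDerivAt_integral_Ioi (hA.smooth.continuous.smul (continuous_aVec hA))
    (integrableOn_smul_aVec hA) s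

theorem hasDerivAt_norm_aVec_sq (hA : Admissible A) (s : ℝ) :
    HasDerivAt (fun t => ‖aVec hA t‖ ^ 2) (-A s ^ 2) s := by
  have hnorm : ∀ t, ‖aVec hA t‖ ^ 2 = ∫ r in Ioi t, A r ^ 2 := fun t => by
    rw [← real_inner_self_eq_norm_sq, inner_aVec_aVec,
      integral_Ioi_comp_add_right (fun r => A r * A r), zero_add]
    simp only [sq]
  rw [funext hnorm]
  exact hasDerivAt_integral_Ioi (hA.smooth.continuous.pow 2) (fun t => (hA.memLp t).integrable_sq) s

theorem hasDerivAt_kKernel (hA : Admissible A) (s x y : ℝ) :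
    HasDerivAt (fun t => kKernel A t x y) (-(A (x + s) * A (y + s))) s := by
  have hc := hA.smooth.continuous
  rw [funext fun t => kKernel_eq_integral_Ioi A t x y, add_comm x, add_comm y]
  exact hasDerivAt_integral_Ioi (by fun_prop) (fun t => (hA.memLp_comp_add_right x t).integrable_mul
    (hA.memLp_comp_add_right y t)) s

end HankelOperator

section Invertibility

variable {A : ℝ → ℝ}

theorem inner_kOp_self_le_of_mem_testFunctions (hA : Admissible A) (s : ℝ) {f : L2}
    (hf : f ∈ testFunctions volume (Ioi 0)) : inner ℝ f (kOp hA s f) ≤ ‖f‖ ^ 2 := by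
  obtain ⟨ψ, hψ, hψc, hψU, hfψ⟩ := hf
  have hzero : ∀ x ∉ Ioi (0 : ℝ), ψ x = 0 := fun x hx =>
    image_eq_zero_of_notMem_tsupport fun h => hx (hψU h)
  have hinner : ∀ r, inner ℝ (aVec hA r) f = ∫ x, A (r + x) * ψ x := fun r => by
    have hz : ∀ x ∉ Ioi (0 : ℝ), A (r + x) * ψ x = 0 := fun x hx => by rw [hzero x hx, mul_zero]
    rw [inner_aVec, ← setIntegral_eq_integral_of_forall_compl_eq_zero hz]
    refine integral_congr_ae ?_
    filter_upwards [hfψ] with x hx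
    rw [hx, add_comm]
  have hnorm : ‖f‖ ^ 2 = ∫ x, ψ x * ψ x := by
    have hz : ∀ x ∉ Ioi (0 : ℝ), ψ x * ψ x = 0 := fun x hx => by rw [hzero x hx, mul_zero]
    rw [← real_inner_self_eq_norm_sq, inner_eq_integral,
      ← setIntegral_eq_integral_of_forall_compl_eq_zero hz]
    refine integral_congr_ae ?_
    filter_upwards [hfψ] with x hx
    rw [hx]
  obtain ⟨hint, heq⟩ := hA.orthogonal ψ ψ hψ hψc hψ hψc
  rw [← integral_inner_aVec_mul, hnorm, ← heq]
  simp only [hinner]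
  exact setIntegral_le_integral hint (ae_of_all _ fun r => mul_self_nonneg _)

theorem inner_kOp_self_le (hA : Admissible A) (s : ℝ) (f : L2) :
    inner ℝ f (kOp hA s f) ≤ ‖f‖ ^ 2 := by
  have hclosed : IsClosed {f : L2 | inner ℝ f (kOp hA s f) ≤ ‖f‖ ^ 2} :=
    isClosed_le (by fun_prop) (by fun_prop)
  exact hclosed.closure_subset_iff.2 (fun f => inner_kOp_self_le_of_mem_testFunctions hA s)
    (dense_testFunctions volume isOpen_Ioi f)

theorem hasDerivAt_inner_kOp_self (hA : Admissible A) (f : L2) (s : ℝ) :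
    HasDerivAt (fun r => inner ℝ f (kOp hA r f)) (-inner ℝ (aVec hA s) f ^ 2) s := by
  have h := (hasDerivAt_const s f).inner ℝ ((hasDerivAt_kOp hA s).clm_apply (hasDerivAt_const s f))
  refine HasDerivAt.congr_deriv h ?_
  simp [inner_smul_right, real_inner_comm, sq]

theorem inner_aVec_eq_zero_of_kOp_eq_self (hA : Admissible A) {s : ℝ} {f : L2}
    (hf : kOp hA s f = f) {r : ℝ} (hr : r ≤ s) : inner ℝ (aVec hA r) f = 0 := by
  have hanti : Antitone fun r => inner ℝ f (kOp hA r f) :=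
    antitone_of_hasDerivAt_nonpos (hasDerivAt_inner_kOp_self hA f)
      fun r => neg_nonpos.2 (sq_nonneg _)
  have hmax : IsLocalMax (fun r => inner ℝ f (kOp hA r f)) r := Eventually.of_forall fun t =>
    calc inner ℝ f (kOp hA t f) ≤ ‖f‖ ^ 2 := inner_kOp_self_le hA t f
      _ = inner ℝ f (kOp hA s f) := by rw [hf, real_inner_self_eq_norm_sq]
      _ ≤ inner ℝ f (kOp hA r f) := hanti hr
  simpa using hmax.hasDerivAt_eq_zero (hasDerivAt_inner_kOp_self hA f r)

theorem kOp_aOp (hA : Admissible A) (s : ℝ) (f : L2) :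
    kOp hA s (aOp hA s f) = aOp hA s (kOp hA s f) := by
  rw [← aOp_aOp, ← aOp_aOp]

theorem inner_aVec_aOp_sub (hA : Admissible A) {s t : ℝ} (ht : 0 ≤ t) {g : L2}
    (hg : ∀ r ≤ s, inner ℝ (aVec hA r) g = 0) (r : ℝ) :
    inner ℝ (aVec hA r) (aOp hA (s - t) g) = inner ℝ (aVec hA (r + t)) (aOp hA s g) := by
  let F : ℝ → ℝ := fun x => A (x + r) * inner ℝ (aVec hA (x + (s - t))) g
  have hF : ∀ x ≤ t, F x = 0 := fun x hx => by
    simp only [F, hg (x + (s - t)) (by linarith), mul_zero]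
  calc inner ℝ (aVec hA r) (aOp hA (s - t) g) = ∫ x in Ioi 0, F x := by
        rw [inner_aVec]
        refine integral_congr_ae ?_
        filter_upwards [aOp_apply_ae hA (s - t) g] with x hx
        rw [hx]
    _ = ∫ x in Ioi t, F x :=
        setIntegral_eq_of_subset_of_forall_sdiff_eq_zero measurableSet_Ioi (Ioi_subset_Ioi ht)
          fun x hx => hF x (not_lt.1 hx.2)
    _ = ∫ x in Ioi 0, F (x + t) := by rw [integral_Ioi_comp_add_right, zero_add]
    _ = inner ℝ (aVec hA (r + t)) (aOp hA s g) := by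
        rw [inner_aVec]
        refine integral_congr_ae ?_
        filter_upwards [aOp_apply_ae hA s g] with x hx
        simp only [F]
        rw [hx, add_assoc x t, add_comm t r, add_assoc x t, add_sub_cancel]

theorem aOp_aOp_sub (hA : Admissible A) {s t : ℝ} (ht : 0 ≤ t) {g : L2}
    (hg : kOp hA s g = g) (σ : ℝ) :
    aOp hA σ (aOp hA (s - t) g) = aOp hA (σ + t) (aOp hA s g) := by
  refine Lp.ext ?_
  filter_upwards [aOp_apply_ae hA σ (aOp hA (s - t) g),
    aOp_apply_ae hA (σ + t) (aOp hA s g)] with x h1 h2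
  rw [h1, h2, ← add_assoc,
    inner_aVec_aOp_sub hA ht fun r hr => inner_aVec_eq_zero_of_kOp_eq_self hA hg hr]

theorem kOp_sub_aOp_sub_aOp (hA : Admissible A) {s t τ : ℝ} (ht : 0 ≤ t) (htτ : t ≤ τ) {f : L2}
    (hf : kOp hA s f = f) :
    kOp hA (s - τ) (aOp hA (s - t) (aOp hA s f)) = aOp hA (s - t) (aOp hA s f) := by
  have hg : kOp hA s (aOp hA s f) = aOp hA s f := by rw [kOp_aOp, hf]
  rw [← aOp_aOp, aOp_aOp_sub hA ht hg, aOp_aOp, hf,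
    show s - τ + t = s - (τ - t) by ring, aOp_aOp_sub hA (sub_nonneg.2 htτ) hf,
    show s - τ + (τ - t) = s - t by ring]

theorem linearIndependent_aOp_sub (hA : Admissible A) {s : ℝ} {f : L2} (hf : kOp hA s f = f)
    (hf0 : f ≠ 0) :
    LinearIndependent ℝ fun t : Icc (0 : ℝ) 1 => aOp hA (s - t) (aOp hA s f) := by
  let Λ : L2 →ₗ[ℝ] ℝ → ℝ := LinearMap.pi fun r => (innerSL ℝ (aVec hA r)).toLinearMap
  have hΛ : ∀ h : L2, Λ h = 0 → aOp hA s h = 0 := fun h hh => by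
    refine Lp.ext ?_
    filter_upwards [aOp_apply_ae hA s h, Lp.coeFn_zero ℝ 2 halfLine] with x h1 h2
    rw [h1, h2]
    exact congrFun hh (x + s)
  have hΛf : Λ f ≠ 0 := fun h => hf0 (by rw [← hf, ← aOp_aOp, hΛ f h, map_zero])
  have hind : LinearIndependent ℝ fun (t : ℝ) (r : ℝ) => Λ f (r + t) :=
    linearIndependent_translates hΛf (b := s) fun r hr =>
      inner_aVec_eq_zero_of_kOp_eq_self hA hf hr
  have hg : kOp hA s (aOp hA s f) = aOp hA s f := by rw [kOp_aOp, hf]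
  refine LinearIndependent.of_comp Λ ?_
  convert hind.comp ((↑) : Icc (0 : ℝ) 1 → ℝ) Subtype.val_injective using 1
  ext t r
  have h := inner_aVec_aOp_sub hA t.2.1
    (fun r hr => inner_aVec_eq_zero_of_kOp_eq_self hA hg hr) r
  rwa [aOp_aOp, hf] at h

theorem eq_zero_of_kOp_eq_self (hA : Admissible A) {s : ℝ} {f : L2}
    (hf : kOp hA s f = f) : f = 0 := by
  by_contra hf0
  let V := Module.End.eigenspace (kOp hA (s - 1)).toLinearMap 1
  have hfin : FiniteDimensional ℝ V :=
    ContinuousLinearMap.finite_dimensional_eigenspace (isCompactOperator_kOp hA (s - 1)) 1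
      one_ne_zero
  have hmem : ∀ t : Icc (0 : ℝ) 1, aOp hA (s - t) (aOp hA s f) ∈ V := fun t => by
    rw [Module.End.mem_eigenspace_iff, one_smul]
    exact kOp_sub_aOp_sub_aOp hA t.2.1 t.2.2 hf
  have hind : LinearIndependent ℝ fun t => (⟨_, hmem t⟩ : V) :=
    .of_comp V.subtype (linearIndependent_aOp_sub hA hf hf0)
  have : Infinite (Icc (0 : ℝ) 1) := (Icc_infinite zero_lt_one).to_subtype
  exact Module.Finite.not_linearIndependent_of_infinite _ hind

theorem isUnit_one_sub_kOp (hA : Admissible A) (s : ℝ) : IsUnit (1 - kOp hA s) := by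
  rcases (isCompactOperator_kOp hA s).hasEigenvalue_or_mem_resolventSet one_ne_zero with h | h
  · obtain ⟨f, hf⟩ := h.exists_hasEigenvector
    refine absurd (eq_zero_of_kOp_eq_self hA (s := s) ?_) hf.2
    simpa using hf.apply_eq_smul
  · simpa only [spectrum.mem_resolventSet_iff, map_one] using h

theorem resolvent_sub_kOp (hA : Admissible A) (s : ℝ) (f : L2) :
    resolvent hA s (f - kOp hA s f) = f :=
  congrArg (fun T : L2 →L[ℝ] L2 => T f) (Ring.inverse_mul_cancel _ (isUnit_one_sub_kOp hA s))

end Invertibility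

section Determinant

theorem det_eq_sub_sum_mul_cramer {R : Type*} [CommRing R] {n : ℕ}
    (M : Matrix (Fin (n + 1)) (Fin (n + 1)) R) :
    M.det = M 0 0 * (M.submatrix Fin.succ Fin.succ).det -
      ∑ j : Fin n, M 0 j.succ *
        (M.submatrix Fin.succ Fin.succ).cramer (fun i => M i.succ 0) j := by
  rw [Matrix.det_succ_row_zero, Fin.sum_univ_succ, sub_eq_add_neg, ← Finset.sum_neg_distrib]
  congr 1
  · simp
  refine Finset.sum_congr rfl fun j _ => ?_
  obtain _ | n := n
  · exact j.elim0
  rw [Matrix.cramer_apply, Matrix.det_succ_column_zero, Matrix.det_succ_column _ j,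
    Finset.mul_sum, Finset.mul_sum, ← Finset.sum_neg_distrib]
  refine Finset.sum_congr rfl fun i _ => ?_
  have hminor : ((M.submatrix Fin.succ Fin.succ).updateCol j fun i => M i.succ 0).submatrix
      i.succAbove j.succAbove =
      (M.submatrix Fin.succ j.succ.succAbove).submatrix i.succAbove Fin.succ := by
    ext p q
    simp
  rw [hminor, Matrix.updateCol_self, Matrix.submatrix_apply, Fin.succ_succAbove_zero, Fin.val_succ]
  ring

theorem abs_det_le_prod_norm_row {n : ℕ} (M : Matrix (Fin n) (Fin n) ℝ) :
    |M.det| ≤ ∏ i, ‖WithLp.toLp 2 (M i)‖ := by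
  have : Fact (Module.finrank ℝ (EuclideanSpace ℝ (Fin n)) = n) := ⟨by simp⟩
  let b := EuclideanSpace.basisFun (Fin n) ℝ
  have h := b.toBasis.orientation.abs_volumeForm_apply_le fun i => WithLp.toLp 2 (M i)
  rwa [b.toBasis.orientation.volumeForm_robust' b, Module.Basis.det_apply,
    show b.toBasis.toMatrix (fun i => WithLp.toLp 2 (M i)) = M.transpose from rfl,
    Matrix.det_transpose] at h

theorem abs_det_le_of_abs_row_le {n : ℕ} {M : Matrix (Fin n) (Fin n) ℝ} {w : Fin n → ℝ}
    (hM : ∀ i j, |M i j| ≤ w i) : |M.det| ≤ √n ^ n * ∏ i, w i := by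
  have hrow : ∀ i, ‖WithLp.toLp 2 (M i)‖ ≤ √n * w i := fun i => by
    have hw : 0 ≤ w i := (abs_nonneg _).trans (hM i i)
    rw [EuclideanSpace.norm_eq]
    refine Real.sqrt_le_iff.2 ⟨by positivity, ?_⟩
    calc ∑ j, ‖M i j‖ ^ 2 ≤ ∑ _j : Fin n, w i ^ 2 :=
          Finset.sum_le_sum fun j _ => pow_le_pow_left₀ (norm_nonneg _) (hM i j) 2
      _ = (√n * w i) ^ 2 := by simp [mul_pow]
  calc |M.det| ≤ ∏ i, ‖WithLp.toLp 2 (M i)‖ := abs_det_le_prod_norm_row M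
    _ ≤ ∏ i, √n * w i := Finset.prod_le_prod (fun i _ => norm_nonneg _) fun i _ => hrow i
    _ = √n ^ n * ∏ i, w i := by simp [Finset.prod_mul_distrib]

theorem hasDerivAt_det {𝕜 : Type*} [NontriviallyNormedField 𝕜] {n : Type*} [Fintype n]
    [DecidableEq n] {M : 𝕜 → Matrix n n 𝕜} {M' : Matrix n n 𝕜} {s : 𝕜}
    (h : ∀ i j, HasDerivAt (fun t => M t i j) (M' i j) s) :
    HasDerivAt (fun t => (M t).det) (∑ j, (M s).cramer (fun i => M' i j) j) s := by
  let f : ContinuousMultilinearMap 𝕜 (fun _ : n => n → 𝕜) 𝕜 :=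
    { (Matrix.detRowAlternating (n := n) (R := 𝕜)).toMultilinearMap with
      cont := Continuous.matrix_det (A := fun N : n → n → 𝕜 => Matrix.of N) continuous_id }
  have hcol : ∀ j, HasDerivAt (fun t => (M t).transpose j) (M'.transpose j) s :=
    fun j => hasDerivAt_pi.2 fun i => h i j
  have hf : ∀ N : Matrix n n 𝕜, f N.transpose = N.det := fun N => Matrix.det_transpose N
  have hderiv := (HasFDerivAt.multilinear_comp (f := f) fun j => (hcol j).hasFDerivAt).hasDerivAt
  refine (hderiv.congr_deriv ?_).congr_of_eventuallyEq (.of_forall fun t => (hf (M t)).symm)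
  simp only [sum_apply, ContinuousLinearMap.comp_apply, ContinuousLinearMap.toSpanSingleton_apply,
    one_smul, ContinuousMultilinearMap.toContinuousLinearMap_apply]
  refine Finset.sum_congr rfl fun j _ => ?_
  rw [← Matrix.transpose_transpose (M s), Matrix.cramer_transpose_apply,
    Matrix.transpose_transpose]
  rfl

/-- Hadamard's bound on the terms of a Fredholm series, up to a factor, for a kernel dominated by a
weight of total mass `x`. -/
def hadamardBound (x : ℝ) (n : ℕ) : ℝ :=
  √(n + 1 : ℕ) ^ (n + 1) * x ^ n / n.factorial

theorem summable_hadamardBound (x : ℝ) : Summable (hadamardBound x) := by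
  have hsmall : ∀ᶠ n : ℕ in atTop, 0 < (n : ℝ) ∧ |x| * Real.exp 1 * √(n + 1 : ℕ) ≤ n / 4 := by
    filter_upwards [eventually_ge_atTop (max 1 ⌈32 * (|x| * Real.exp 1) ^ 2⌉₊)] with n hn
    have h1 : (1 : ℝ) ≤ n := mod_cast (le_max_left _ _).trans hn
    have h2 : 32 * (|x| * Real.exp 1) ^ 2 ≤ n := Nat.ceil_le.1 ((le_max_right _ _).trans hn)
    refine ⟨by linarith, le_of_sq_le_sq ?_ (by positivity)⟩
    rw [mul_pow, Real.sq_sqrt (by positivity)]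
    push_cast
    nlinarith [sq_nonneg (|x| * Real.exp 1)]
  refine Summable.of_norm_bounded_eventually_nat
    (summable_geometric_of_lt_one (r := 1 / 2) (by norm_num) (by norm_num)) ?_
  filter_upwards [hsmall] with n ⟨hn0, hn⟩
  -- `n! ≥ (n / e) ^ n`
  have hfact : (n : ℝ) ^ n ≤ Real.exp 1 ^ n * n.factorial := by
    have h := Real.pow_div_factorial_le_exp (n : ℝ) hn0.le n
    rwa [div_le_iff₀ (by positivity), ← mul_one (n : ℝ), Real.exp_nat_mul, mul_one] at h
  have hsqrt : √(n + 1 : ℕ) ≤ 2 ^ n :=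
    calc √(n + 1 : ℕ) ≤ (n + 1 : ℕ) := Real.sqrt_le_self_iff.2 (.inr (by simp))
      _ ≤ 2 ^ n := mod_cast Nat.lt_two_pow_self
  rw [hadamardBound, norm_div, norm_mul, norm_pow, norm_pow,
    Real.norm_of_nonneg (Real.sqrt_nonneg _), Real.norm_natCast, Real.norm_eq_abs,
    div_le_iff₀ (by positivity)]
  refine le_of_mul_le_mul_left ?_ (pow_pos (Real.exp_pos 1) n)
  calc Real.exp 1 ^ n * (√(n + 1 : ℕ) ^ (n + 1) * |x| ^ n)
      = √(n + 1 : ℕ) * (|x| * Real.exp 1 * √(n + 1 : ℕ)) ^ n := by ring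
    _ ≤ 2 ^ n * (n / 4) ^ n := by gcongr
    _ = (1 / 2) ^ n * n ^ n := by
        rw [← mul_pow, ← mul_pow]
        ring_nf
    _ ≤ (1 / 2) ^ n * (Real.exp 1 ^ n * n.factorial) := by gcongr
    _ = Real.exp 1 ^ n * ((1 / 2) ^ n * n.factorial) := by ring

end Determinant

section Fredholm

theorem measurable_det {Ω ι : Type*} [MeasurableSpace Ω] [Fintype ι] [DecidableEq ι]
    {M : Ω → Matrix ι ι ℝ} (hM : ∀ i j, Measurable fun t => M t i j) :
    Measurable fun t => (M t).det := by
  simp only [Matrix.det_apply]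
  exact Finset.measurable_sum _ fun σ _ =>
    (Finset.measurable_prod _ fun i _ => hM (σ i) i).const_smul _

section KernelMatrix

variable {X : Type*}

/-- The matrix `[k(yᵢ, yⱼ)]` whose determinants make up the Fredholm series. -/
def kernelMatrix {ι : Type*} (k : X → X → ℝ) (y : ι → X) : Matrix ι ι ℝ :=
  Matrix.of fun i j => k (y i) (y j)

variable {k : X → X → ℝ} {a : X → ℝ}

theorem kernelMatrix_comp_perm {ι : Type*} (σ : Equiv.Perm ι) (y : ι → X) :
    kernelMatrix k (y ∘ σ) = (kernelMatrix k y).submatrix σ σ :=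
  rfl

theorem cramer_kernelMatrix_comp_perm {ι : Type*} [Fintype ι] [DecidableEq ι]
    (σ : Equiv.Perm ι) (y : ι → X) (j : ι) :
    (kernelMatrix k (y ∘ σ)).cramer (a ∘ y ∘ σ) j =
      (kernelMatrix k y).cramer (a ∘ y) (σ j) := by
  rw [kernelMatrix_comp_perm, Matrix.cramer_submatrix_equiv]
  simp [Function.comp_def]

theorem cramer_kernelMatrix_cons {m : ℕ} (x : X) (y : Fin m → X) :
    (kernelMatrix k (Fin.cons x y : Fin (m + 1) → X)).cramer
        (a ∘ (Fin.cons x y : Fin (m + 1) → X)) 0 =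
      a x * (kernelMatrix k y).det -
        ∑ j, k x (y j) * (kernelMatrix k y).cramer (a ∘ y) j := by
  have hsub : ((kernelMatrix k (Fin.cons x y : Fin (m + 1) → X)).updateCol 0
      (a ∘ (Fin.cons x y : Fin (m + 1) → X))).submatrix Fin.succ Fin.succ = kernelMatrix k y := by
    ext i j
    simp [kernelMatrix]
  rw [Matrix.cramer_apply, det_eq_sub_sum_mul_cramer, hsub]
  simp [kernelMatrix, Function.comp_def]

end KernelMatrix

variable {X : Type*} [MeasurableSpace X]

section ProductMeasure

theorem integral_pi_comp_perm {ι E : Type*} [Fintype ι] [NormedAddCommGroup E] [NormedSpace ℝ E]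
    (μ : Measure X) [SigmaFinite μ] (σ : Equiv.Perm ι) (F : (ι → X) → E) :
    ∫ y, F (y ∘ σ) ∂Measure.pi (fun _ => μ) = ∫ y, F y ∂Measure.pi fun _ => μ := by
  rw [← (measurePreserving_piCongrLeft (fun _ => μ) σ.symm).integral_comp' F]
  congr with y
  congr 1 with j
  simpa [MeasurableEquiv.coe_piCongrLeft] using
    (Equiv.piCongrLeft_apply_apply (P := fun _ => X) (e := σ.symm) y (σ j)).symm

theorem integral_pi_fin_succ {E : Type*} [NormedAddCommGroup E] [NormedSpace ℝ E]
    {μ : Measure X} [SigmaFinite μ] {m : ℕ} {F : (Fin (m + 1) → X) → E}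
    (hF : Integrable F (Measure.pi fun _ => μ)) :
    ∫ y, F y ∂Measure.pi (fun _ => μ) =
      ∫ x, ∫ y, F (Fin.cons x y) ∂Measure.pi (fun _ : Fin m => μ) ∂μ := by
  have hp := (measurePreserving_piFinSuccAbove (fun _ : Fin (m + 1) => μ) 0).symm
  rw [← hp.integrable_comp_emb (MeasurableEquiv.measurableEmbedding _)] at hF
  rw [← hp.integral_comp']
  refine (integral_prod _ hF).trans ?_
  simp [MeasurableEquiv.piFinSuccAbove_symm_apply, Fin.insertNthEquiv]

theorem ae_pi_forall_mem {ι : Type*} [Fintype ι] {μ : Measure X} [SigmaFinite μ] {S : Set X}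
    (hS : ∀ᵐ x ∂μ, x ∈ S) : ∀ᵐ y ∂Measure.pi fun _ : ι => μ, ∀ i, y i ∈ S :=
  eventually_all.2 fun _ => Measure.tendsto_eval_ae_ae.eventually hS

end ProductMeasure

/-- The `n`-th Fredholm coefficient `∫ det[k(yᵢ, yⱼ)] dy` of a kernel. -/
def detIntegral (μ : Measure X) (k : X → X → ℝ) (n : ℕ) : ℝ :=
  ∫ y, (kernelMatrix k y).det ∂Measure.pi fun _ : Fin n => μ

/-- The Fredholm determinant of `1 - k`. -/
def detSeries (μ : Measure X) (k : X → X → ℝ) : ℝ :=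
  1 + ∑' n : ℕ, (-1) ^ (n + 1) / ((n + 1).factorial : ℝ) * detIntegral μ k (n + 1)

/-- The coefficients of Fredholm's numerator series: the matrix of `k` at the points
`x, y₁, …, yₘ`, with its first column replaced by the values of `a`, has its determinant
integrated over `y`. -/
def cramerIntegral (μ : Measure X) (k : X → X → ℝ) (a : X → ℝ) (m : ℕ) (x : X) : ℝ :=
  ∫ y, (kernelMatrix k (Fin.cons x y : Fin (m + 1) → X)).cramer
    (a ∘ (Fin.cons x y : Fin (m + 1) → X)) 0 ∂Measure.pi fun _ : Fin m => μ

/-- Fredholm's numerator series, which solves `(1 - k) f = detSeries μ k • a`. -/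
def cramerSeries (μ : Measure X) (k : X → X → ℝ) (a : X → ℝ) (x : X) : ℝ :=
  ∑' m : ℕ, (-1) ^ m / (m.factorial : ℝ) * cramerIntegral μ k a m x

/-- A measurable kernel dominated, on a set `S` carrying `μ`, by an integrable weight of its first
variable; this makes the Fredholm series of `k` converge. -/
structure RowDominated (μ : Measure X) (S : Set X) (w : X → ℝ) (k : X → X → ℝ) : Prop where
  ae_mem : ∀ᵐ x ∂μ, x ∈ S
  integrable_weight : Integrable w μ
  measurable_kernel : Measurable (Function.uncurry k)
  abs_le : ∀ x ∈ S, ∀ y ∈ S, |k x y| ≤ w x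

variable {μ : Measure X} {S : Set X} {w : X → ℝ} {k : X → X → ℝ} {a b : X → ℝ} {M : ℝ}

theorem cramerIntegral_zero [SigmaFinite μ] (x : X) : cramerIntegral μ k a 0 x = a x := by
  simp [cramerIntegral, measureReal_def, Matrix.cramer_subsingleton_apply]

theorem measurable_kernelMatrix_apply {ι : Type*} (hk : Measurable (Function.uncurry k))
    (i j : ι) : Measurable fun y : ι → X => kernelMatrix k y i j := by
  simp only [kernelMatrix, Matrix.of_apply]
  exact hk.comp (by fun_prop : Measurable fun y : ι → X => (y i, y j))

theorem measurable_cramer_kernelMatrix {ι : Type*} [Fintype ι] [DecidableEq ι]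
    (hk : Measurable (Function.uncurry k)) (ha : Measurable a) (j : ι) :
    Measurable fun y : ι → X => (kernelMatrix k y).cramer (a ∘ y) j := by
  simp only [Matrix.cramer_apply]
  refine measurable_det fun p q => ?_
  simp only [Matrix.updateCol_apply]
  split_ifs
  · exact ha.comp (measurable_pi_apply p)
  · exact measurable_kernelMatrix_apply hk p q

theorem measurable_cramerIntegral [SigmaFinite μ] (hk : Measurable (Function.uncurry k))
    (ha : Measurable a) (m : ℕ) : Measurable (cramerIntegral μ k a m) := by
  have hcons : Measurable fun p : X × (Fin m → X) => (Fin.cons p.1 p.2 : Fin (m + 1) → X) :=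
    measurable_pi_lambda _ <| Fin.cases (by simpa using measurable_fst) fun i => by
      simpa [Function.comp_def] using (measurable_pi_apply i).comp measurable_snd
  exact ((measurable_cramer_kernelMatrix hk ha 0).comp
    hcons).stronglyMeasurable.integral_prod_right'.measurable

namespace RowDominated

theorem abs_det_le (h : RowDominated μ S w k) {n : ℕ} {y : Fin n → X} (hy : ∀ i, y i ∈ S) :
    |(kernelMatrix k y).det| ≤ √n ^ n * ∏ i, w (y i) :=
  abs_det_le_of_abs_row_le fun i j => h.abs_le _ (hy i) _ (hy j)

theorem abs_cramer_le (h : RowDominated μ S w k) (haw : ∀ x ∈ S, |a x| ≤ w x) {n : ℕ}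
    {y : Fin n → X} (hy : ∀ i, y i ∈ S) (j : Fin n) :
    |(kernelMatrix k y).cramer (a ∘ y) j| ≤ √n ^ n * ∏ i, w (y i) := by
  rw [Matrix.cramer_apply]
  refine abs_det_le_of_abs_row_le fun p q => ?_
  rw [Matrix.updateCol_apply]
  split_ifs
  · exact haw _ (hy p)
  · exact h.abs_le _ (hy p) _ (hy q)

theorem weight_nonneg (h : RowDominated μ S w k) {x : X} (hx : x ∈ S) : 0 ≤ w x :=
  (abs_nonneg _).trans (h.abs_le x hx x hx)

theorem integral_weight_nonneg (h : RowDominated μ S w k) : 0 ≤ ∫ x, w x ∂μ :=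
  integral_nonneg_of_ae (h.ae_mem.mono fun _ => h.weight_nonneg)

variable [SigmaFinite μ]

theorem integrable_prod_weight (h : RowDominated μ S w k) (n : ℕ) :
    Integrable (fun y : Fin n → X => ∏ i, w (y i)) (Measure.pi fun _ => μ) :=
  Integrable.fintype_prod (f := fun _ => w) fun _ => h.integrable_weight

theorem integrable_det (h : RowDominated μ S w k) (n : ℕ) :
    Integrable (fun y : Fin n → X => (kernelMatrix k y).det) (Measure.pi fun _ => μ) := by
  refine ((h.integrable_prod_weight n).const_mul (√n ^ n)).mono'
    (measurable_det (measurable_kernelMatrix_apply h.measurable_kernel)).aestronglyMeasurable ?_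
  filter_upwards [ae_pi_forall_mem h.ae_mem] with y hy using h.abs_det_le hy

theorem abs_detIntegral_le (h : RowDominated μ S w k) (n : ℕ) :
    |detIntegral μ k n| ≤ √n ^ n * (∫ x, w x ∂μ) ^ n := by
  rw [detIntegral, ← Real.norm_eq_abs]
  refine (norm_integral_le_of_norm_le
    ((h.integrable_prod_weight n).const_mul (√n ^ n)) ?_).trans_eq ?_
  · filter_upwards [ae_pi_forall_mem h.ae_mem] with y hy using h.abs_det_le hy
  · rw [integral_const_mul, integral_fintype_prod_eq_pow w, Fintype.card_fin]

theorem abs_cramerIntegral_le (h : RowDominated μ S w k) (haw : ∀ x ∈ S, |a x| ≤ w x) (m : ℕ)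
    {x : X} (hx : x ∈ S) :
    |cramerIntegral μ k a m x| ≤ √(m + 1 : ℕ) ^ (m + 1) * (∫ x, w x ∂μ) ^ m * w x := by
  rw [cramerIntegral, ← Real.norm_eq_abs]
  refine (norm_integral_le_of_norm_le
    ((h.integrable_prod_weight m).const_mul (√(m + 1 : ℕ) ^ (m + 1) * w x)) ?_).trans_eq ?_
  · filter_upwards [ae_pi_forall_mem h.ae_mem] with y hy
    have hxy : ∀ i, (Fin.cons x y : Fin (m + 1) → X) i ∈ S :=
      Fin.cases (by simpa using hx) fun i => by simpa using hy i
    simpa [Fin.prod_univ_succ, mul_assoc] using h.abs_cramer_le haw hxy 0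
  · rw [integral_const_mul, integral_fintype_prod_eq_pow w, Fintype.card_fin, mul_right_comm]

theorem integrable_mul_cramer (h : RowDominated μ S w k) (ha : Measurable a)
    (haw : ∀ x ∈ S, |a x| ≤ w x) (hb : Measurable b) (hbM : ∀ x ∈ S, |b x| ≤ M) {n : ℕ}
    (j : Fin n) :
    Integrable (fun y : Fin n → X => b (y j) * (kernelMatrix k y).cramer (a ∘ y) j)
      (Measure.pi fun _ => μ) := by
  refine ((h.integrable_prod_weight n).const_mul (M * √n ^ n)).mono'
    ((hb.comp (measurable_pi_apply j)).mul
      (measurable_cramer_kernelMatrix h.measurable_kernel ha j)).aestronglyMeasurable ?_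
  filter_upwards [ae_pi_forall_mem h.ae_mem] with y hy
  rw [Real.norm_eq_abs, abs_mul, mul_assoc]
  exact mul_le_mul (hbM _ (hy j)) (h.abs_cramer_le haw hy j) (abs_nonneg _)
    ((abs_nonneg _).trans (hbM _ (hy j)))

theorem integral_sum_mul_cramer (h : RowDominated μ S w k) (ha : Measurable a)
    (haw : ∀ x ∈ S, |a x| ≤ w x) (hb : Measurable b) (hbM : ∀ x ∈ S, |b x| ≤ M) (m : ℕ) :
    ∫ y : Fin (m + 1) → X, ∑ j, b (y j) * (kernelMatrix k y).cramer (a ∘ y) j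
        ∂Measure.pi (fun _ => μ) =
      (m + 1) * ∫ x, b x * cramerIntegral μ k a m x ∂μ := by
  have hint := fun j : Fin (m + 1) => h.integrable_mul_cramer ha haw hb hbM j
  have hterm : ∀ j : Fin (m + 1),
      ∫ y : Fin (m + 1) → X, b (y j) * (kernelMatrix k y).cramer (a ∘ y) j
        ∂Measure.pi (fun _ => μ) = ∫ x, b x * cramerIntegral μ k a m x ∂μ := fun j => by
    rw [← integral_pi_comp_perm μ (Equiv.swap 0 j)]
    simp only [cramer_kernelMatrix_comp_perm, Function.comp_apply, Equiv.swap_apply_right]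
    rw [integral_pi_fin_succ (hint 0)]
    simp only [Fin.cons_zero, integral_const_mul, cramerIntegral]
  simp only [integral_finsetSum _ fun j _ => hint j, hterm]
  simp

theorem cramerIntegral_succ (h : RowDominated μ S w k) (ha : Measurable a)
    (haw : ∀ x ∈ S, |a x| ≤ w x) (m : ℕ) {x : X} (hx : x ∈ S) :
    cramerIntegral μ k a (m + 1) x = a x * detIntegral μ k (m + 1) -
      (m + 1) * ∫ z, k x z * cramerIntegral μ k a m z ∂μ := by
  have hkx : Measurable (k x) := h.measurable_kernel.comp measurable_prodMk_left
  rw [← h.integral_sum_mul_cramer ha haw hkx (h.abs_le x hx), detIntegral, ← integral_const_mul,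
    ← integral_sub ((h.integrable_det _).const_mul _) (integrable_finsetSum _ fun j _ =>
      h.integrable_mul_cramer ha haw hkx (h.abs_le x hx) j)]
  simp only [cramerIntegral, cramer_kernelMatrix_cons]

end RowDominated

end Fredholm

section FredholmSeries

theorem hasDerivAt_det_kernelMatrix {X : Type*} {k : ℝ → X → X → ℝ} {a b : ℝ → X → ℝ} {s : ℝ}
    {n : ℕ} {y : Fin n → X}
    (hk : ∀ i j, HasDerivAt (fun t => k t (y i) (y j)) (-(a s (y i) * b s (y j))) s) :
    HasDerivAt (fun t => (kernelMatrix (k t) y).det)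
      (-∑ j, b s (y j) * (kernelMatrix (k s) y).cramer (a s ∘ y) j) s := by
  refine (hasDerivAt_det (M := fun t => kernelMatrix (k t) y) hk).congr_deriv ?_
  rw [← Finset.sum_neg_distrib]
  refine Finset.sum_congr rfl fun j _ => ?_
  have hcol : (fun i => -(a s (y i) * b s (y j))) = -(b s (y j)) • (a s ∘ y) := by
    ext i
    simp [mul_comm]
  rw [hcol, map_smul, Pi.smul_apply, smul_eq_mul, neg_mul]

variable {X : Type*} [MeasurableSpace X] {μ : Measure X} [SigmaFinite μ] {S : Set X}
  {w : X → ℝ} {k : X → X → ℝ} {a b : X → ℝ} {M : ℝ}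

namespace RowDominated

theorem abs_detSeries_term_le (h : RowDominated μ S w k) (n : ℕ) :
    |(-1) ^ (n + 1) / ((n + 1).factorial : ℝ) * detIntegral μ k (n + 1)| ≤
      (∫ x, w x ∂μ) * hadamardBound (∫ x, w x ∂μ) n := by
  have hL := h.integral_weight_nonneg
  have hfact : (n.factorial : ℝ) ≤ (n + 1).factorial :=
    mod_cast Nat.factorial_le n.le_succ
  calc |(-1) ^ (n + 1) / ((n + 1).factorial : ℝ) * detIntegral μ k (n + 1)|
      = |detIntegral μ k (n + 1)| / (n + 1).factorial := by
        simp [abs_mul, abs_div, div_mul_eq_mul_div]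
    _ ≤ √(n + 1 : ℕ) ^ (n + 1) * (∫ x, w x ∂μ) ^ (n + 1) / n.factorial := by
        gcongr
        exact h.abs_detIntegral_le (n + 1)
    _ = (∫ x, w x ∂μ) * hadamardBound (∫ x, w x ∂μ) n := by
        rw [hadamardBound]
        ring

theorem summable_detSeries (h : RowDominated μ S w k) :
    Summable fun n : ℕ => (-1) ^ (n + 1) / ((n + 1).factorial : ℝ) * detIntegral μ k (n + 1) :=
  .of_norm_bounded ((summable_hadamardBound _).mul_left _)
    h.abs_detSeries_term_le

theorem abs_detSeries_sub_one_le (h : RowDominated μ S w k) :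
    |detSeries μ k - 1| ≤ (∫ x, w x ∂μ) * ∑' n, hadamardBound (∫ x, w x ∂μ) n := by
  rw [detSeries, add_sub_cancel_left, ← tsum_mul_left, ← Real.norm_eq_abs]
  exact tsum_of_norm_bounded
    ((summable_hadamardBound _).mul_left _).hasSum h.abs_detSeries_term_le

theorem abs_cramerSeries_term_le (h : RowDominated μ S w k) (haw : ∀ x ∈ S, |a x| ≤ w x)
    (m : ℕ) {x : X} (hx : x ∈ S) :
    |(-1) ^ m / (m.factorial : ℝ) * cramerIntegral μ k a m x| ≤
      w x * hadamardBound (∫ x, w x ∂μ) m := by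
  calc |(-1) ^ m / (m.factorial : ℝ) * cramerIntegral μ k a m x|
      = |cramerIntegral μ k a m x| / m.factorial := by
        simp [abs_mul, abs_div, div_mul_eq_mul_div]
    _ ≤ √(m + 1 : ℕ) ^ (m + 1) * (∫ x, w x ∂μ) ^ m * w x / m.factorial := by
        gcongr
        exact h.abs_cramerIntegral_le haw m hx
    _ = w x * hadamardBound (∫ x, w x ∂μ) m := by
        rw [hadamardBound]
        ring

theorem summable_cramerSeries (h : RowDominated μ S w k) (haw : ∀ x ∈ S, |a x| ≤ w x) {x : X}
    (hx : x ∈ S) :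
    Summable fun m : ℕ => (-1) ^ m / (m.factorial : ℝ) * cramerIntegral μ k a m x :=
  .of_norm_bounded ((summable_hadamardBound _).mul_left _)
    fun m => h.abs_cramerSeries_term_le haw m hx

theorem abs_cramerSeries_le (h : RowDominated μ S w k) (haw : ∀ x ∈ S, |a x| ≤ w x) {x : X}
    (hx : x ∈ S) : |cramerSeries μ k a x| ≤ w x * ∑' m, hadamardBound (∫ x, w x ∂μ) m := by
  rw [cramerSeries, ← tsum_mul_left, ← Real.norm_eq_abs]
  exact tsum_of_norm_bounded ((summable_hadamardBound _).mul_left _).hasSum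
    fun m => h.abs_cramerSeries_term_le haw m hx

theorem aestronglyMeasurable_cramerSeries (h : RowDominated μ S w k) (ha : Measurable a)
    (haw : ∀ x ∈ S, |a x| ≤ w x) : AEStronglyMeasurable (cramerSeries μ k a) μ := by
  refine aestronglyMeasurable_of_tendsto_ae atTop (f := fun n x => ∑ m ∈ Finset.range n,
    (-1) ^ m / (m.factorial : ℝ) * cramerIntegral μ k a m x) (fun n => ?_) ?_
  · exact (Finset.measurable_sum _ fun m _ =>
      (measurable_cramerIntegral h.measurable_kernel ha m).const_mul _).aestronglyMeasurable
  · filter_upwards [h.ae_mem] with x hx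
    exact (h.summable_cramerSeries haw hx).hasSum.tendsto_sum_nat

theorem memLp_cramerSeries (h : RowDominated μ S w k) (ha : Measurable a)
    (haw : ∀ x ∈ S, |a x| ≤ w x) {p : ℝ≥0∞} (hw : MemLp w p μ) : MemLp (cramerSeries μ k a) p μ :=
  (hw.mul_const _).mono' (h.aestronglyMeasurable_cramerSeries ha haw)
    (h.ae_mem.mono fun _ hx => h.abs_cramerSeries_le haw hx)

theorem hasSum_integral_mul_cramerIntegral (h : RowDominated μ S w k) (ha : Measurable a)
    (haw : ∀ x ∈ S, |a x| ≤ w x) (hb : Measurable b) (hbM : ∀ x ∈ S, |b x| ≤ M) :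
    HasSum (fun m : ℕ => (-1) ^ m / (m.factorial : ℝ) * ∫ x, b x * cramerIntegral μ k a m x ∂μ)
      (∫ x, b x * cramerSeries μ k a x ∂μ) := by
  have hsum := summable_hadamardBound (∫ x, w x ∂μ)
  simp only [← integral_const_mul, mul_left_comm _ (b _)]
  refine hasSum_integral_of_dominated_convergence
    (fun m x => M * (w x * hadamardBound (∫ x, w x ∂μ) m)) (fun m => ?_) (fun m => ?_) ?_ ?_ ?_
  · exact (hb.mul ((measurable_cramerIntegral h.measurable_kernel ha m).const_mul
      _)).aestronglyMeasurable
  · filter_upwards [h.ae_mem] with x hx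
    rw [Real.norm_eq_abs, abs_mul]
    exact mul_le_mul (hbM x hx) (h.abs_cramerSeries_term_le haw m hx) (abs_nonneg _)
      ((abs_nonneg _).trans (hbM x hx))
  · exact ae_of_all _ fun x => (hsum.mul_left _).mul_left _
  · simp only [tsum_mul_left]
    exact (h.integrable_weight.mul_const _).const_mul _
  · filter_upwards [h.ae_mem] with x hx
    exact (h.summable_cramerSeries haw hx).hasSum.mul_left _

theorem cramerSeries_eq (h : RowDominated μ S w k) (ha : Measurable a)
    (haw : ∀ x ∈ S, |a x| ≤ w x) {x : X} (hx : x ∈ S) :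
    cramerSeries μ k a x = detSeries μ k * a x + ∫ z, k x z * cramerSeries μ k a z ∂μ := by
  have hterm : ∀ m : ℕ,
      (-1) ^ (m + 1) / ((m + 1).factorial : ℝ) * cramerIntegral μ k a (m + 1) x =
        (-1) ^ (m + 1) / ((m + 1).factorial : ℝ) * detIntegral μ k (m + 1) * a x +
          (-1) ^ m / (m.factorial : ℝ) * ∫ z, k x z * cramerIntegral μ k a m z ∂μ := fun m => by
    rw [h.cramerIntegral_succ ha haw m hx, Nat.factorial_succ, pow_succ]
    push_cast
    field_simp
    ring
  have hkx : Measurable (k x) := h.measurable_kernel.comp measurable_prodMk_left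
  have htail := (h.summable_detSeries.hasSum.mul_right (a x)).add
    (h.hasSum_integral_mul_cramerIntegral ha haw hkx (h.abs_le x hx))
  rw [cramerSeries, (h.summable_cramerSeries haw hx).tsum_eq_zero_add, cramerIntegral_zero,
    funext hterm, htail.tsum_eq, detSeries, pow_zero, Nat.factorial_zero, Nat.cast_one, div_one]
  ring

end RowDominated

section Variation

variable {k : ℝ → X → X → ℝ} {a b : ℝ → X → ℝ} {U : Set ℝ} {s : ℝ}

variable (hU : IsOpen U) (hk : ∀ t ∈ U, RowDominated μ S w (k t))
  (ha : ∀ t ∈ U, Measurable (a t)) (haw : ∀ t ∈ U, ∀ x ∈ S, |a t x| ≤ w x)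
  (hb : ∀ t ∈ U, Measurable (b t)) (hbM : ∀ t ∈ U, ∀ x ∈ S, |b t x| ≤ M)
  (hk' : ∀ t ∈ U, ∀ x ∈ S, ∀ y ∈ S, HasDerivAt (fun t => k t x y) (-(a t x * b t y)) t)
include hU hk ha haw hb hbM hk'

theorem hasDerivAt_detIntegral_succ (hs : s ∈ U) (n : ℕ) :
    HasDerivAt (fun t => detIntegral μ (k t) (n + 1))
      (-((n + 1) * ∫ x, b s x * cramerIntegral μ (k s) (a s) n x ∂μ)) s := by
  rw [← (hk s hs).integral_sum_mul_cramer (ha s hs) (haw s hs) (hb s hs) (hbM s hs),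
    ← integral_neg]
  refine (hasDerivAt_integral_of_dominated_loc_of_deriv_le (hU.mem_nhds hs)
    (bound := fun y => ∑ _j : Fin (n + 1), M * (√(n + 1 : ℕ) ^ (n + 1) * ∏ i, w (y i)))
    (F' := fun t y => -∑ j, b t (y j) * (kernelMatrix (k t) y).cramer (a t ∘ y) j)
    ?_ ((hk s hs).integrable_det _) ?_ ?_ ?_ ?_).2
  · filter_upwards [hU.mem_nhds hs] with t ht using ((hk t ht).integrable_det _).1
  · exact (integrable_finsetSum _ fun j _ => (hk s hs).integrable_mul_cramer (ha s hs) (haw s hs)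
      (hb s hs) (hbM s hs) j).neg.1
  · filter_upwards [ae_pi_forall_mem (hk s hs).ae_mem] with y hy t ht
    rw [norm_neg]
    refine norm_sum_le_of_le _ fun j _ => ?_
    rw [Real.norm_eq_abs, abs_mul]
    exact mul_le_mul (hbM t ht _ (hy j)) ((hk t ht).abs_cramer_le (haw t ht) hy j) (abs_nonneg _)
      ((abs_nonneg _).trans (hbM t ht _ (hy j)))
  · exact integrable_finsetSum _ fun _ _ =>
      (((hk s hs).integrable_prod_weight _).const_mul _).const_mul _
  · filter_upwards [ae_pi_forall_mem (hk s hs).ae_mem] with y hy t ht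
    exact hasDerivAt_det_kernelMatrix fun i j => hk' t ht _ (hy i) _ (hy j)

theorem hasDerivAt_detSeries (hU' : IsPreconnected U) (hs : s ∈ U) :
    HasDerivAt (fun t => detSeries μ (k t)) (∫ x, b s x * cramerSeries μ (k s) (a s) x ∂μ) s := by
  have hterm : ∀ (n : ℕ), ∀ t ∈ U, HasDerivAt
      (fun t => (-1) ^ (n + 1) / ((n + 1).factorial : ℝ) * detIntegral μ (k t) (n + 1))
      ((-1) ^ n / (n.factorial : ℝ) *
        ∫ x, b t x * cramerIntegral μ (k t) (a t) n x ∂μ) t := fun n t ht => by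
    refine ((hasDerivAt_detIntegral_succ hU hk ha haw hb hbM hk' ht n).const_mul _).congr_deriv ?_
    rw [Nat.factorial_succ, pow_succ]
    push_cast
    field_simp
  have hbound : ∀ (n : ℕ), ∀ t ∈ U, ‖(-1) ^ n / (n.factorial : ℝ) *
      ∫ x, b t x * cramerIntegral μ (k t) (a t) n x ∂μ‖ ≤
        ∫ x, M * (w x * hadamardBound (∫ x, w x ∂μ) n) ∂μ := fun n t ht => by
    rw [← integral_const_mul]
    refine norm_integral_le_of_norm_le
      (((hk t ht).integrable_weight.mul_const _).const_mul _) ?_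
    filter_upwards [(hk t ht).ae_mem] with x hx
    rw [mul_left_comm, Real.norm_eq_abs, abs_mul]
    exact mul_le_mul (hbM t ht x hx) ((hk t ht).abs_cramerSeries_term_le (haw t ht) n hx)
      (abs_nonneg _) ((abs_nonneg _).trans (hbM t ht x hx))
  have hsummable : Summable fun n =>
      ∫ x, M * (w x * hadamardBound (∫ x, w x ∂μ) n) ∂μ := by
    simp only [integral_const_mul, integral_mul_const]
    exact ((summable_hadamardBound _).mul_left _).mul_left _
  have hsum := (hk s hs).hasSum_integral_mul_cramerIntegral (ha s hs) (haw s hs) (hb s hs)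
    (hbM s hs)
  rw [← hsum.tsum_eq]
  exact (hasDerivAt_tsum_of_isPreconnected hsummable hU hU' hterm hbound hs
    (hk s hs).summable_detSeries hs).const_add 1

end Variation

end FredholmSeries

section FredholmDeterminant

variable {A : ℝ → ℝ}

theorem fredholmCoeff_eq_detIntegral (k : ℝ → ℝ → ℝ) (n : ℕ) :
    fredholmCoeff k n = detIntegral halfLine k n := by
  rw [fredholmCoeff, volume_pi, Measure.restrict_pi_pi]
  rfl

theorem fredholmDet_eq_detSeries (k : ℝ → ℝ → ℝ) : fredholmDet k = detSeries halfLine k := by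
  simp only [fredholmDet, detSeries, fredholmCoeff_eq_detIntegral]

theorem RowDominated.fredholmSeriesConverges {k : ℝ → ℝ → ℝ} {S : Set ℝ} {w : ℝ → ℝ}
    (h : RowDominated halfLine S w k) : FredholmSeriesConverges k := by
  refine ⟨fun n => ?_, ?_⟩
  · rw [IntegrableOn, volume_pi, Measure.restrict_pi_pi]
    exact h.integrable_det n
  · simpa only [fredholmCoeff_eq_detIntegral] using h.summable_detSeries

theorem Admissible.measurable_comp_add_right (hA : Admissible A) (s : ℝ) :
    Measurable fun x => A (x + s) :=
  (hA.smooth.continuous.comp (continuous_add_const s)).measurable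

theorem Admissible.exists_rowDominated (hA : Admissible A) (S : ℝ) :
    ∃ C c : ℝ, 0 ≤ C ∧ 0 < c ∧ ∀ s t, S ≤ s → s ≤ t →
      RowDominated halfLine (Ioi 0) (fun x => C * Real.exp (-c * (s - S)) * Real.exp (-c * x))
        (kKernel A t) ∧
      ∀ x ∈ Ioi (0 : ℝ), |A (x + t)| ≤ C * Real.exp (-c * (s - S)) * Real.exp (-c * x) := by
  obtain ⟨C, c, hC, hc, hb⟩ := hA.exists_norm_aVec_le S
  have hmono : ∀ {D s t x : ℝ}, 0 ≤ D → D ≤ C + 1 → s ≤ t →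
      C * Real.exp (-c * (x + t - S)) * D ≤
        C * (C + 1) * Real.exp (-c * (s - S)) * Real.exp (-c * x) := fun {D s t x} h0 hD hst => by
    have hexp : Real.exp (-c * (x + t - S)) ≤ Real.exp (-c * (s - S)) * Real.exp (-c * x) := by
      rw [← Real.exp_add]
      exact Real.exp_le_exp.2 (by nlinarith)
    calc C * Real.exp (-c * (x + t - S)) * D
        ≤ C * (Real.exp (-c * (s - S)) * Real.exp (-c * x)) * (C + 1) := by gcongr
      _ = C * (C + 1) * Real.exp (-c * (s - S)) * Real.exp (-c * x) := by ring
  refine ⟨C * (C + 1), c, by positivity, hc, fun s t hs hst => ⟨⟨ae_restrict_mem measurableSet_Ioi,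
    (exp_neg_integrableOn_Ioi 0 hc).const_mul _, (stronglyMeasurable_kKernel hA t).measurable,
    fun x hx y hy => ?_⟩, fun x hx => ?_⟩⟩
  · have hx' : 0 < x := hx
    have hy' : 0 < y := hy
    have hyC : ‖aVec hA (y + t)‖ ≤ C :=
      (hb (y + t) (by linarith)).2.trans
        (mul_le_of_le_one_right hC.le (Real.exp_le_one_iff.2 (by nlinarith)))
    rw [kKernel_eq_inner hA]
    exact (abs_real_inner_le_norm _ _).trans <|
      (mul_le_mul_of_nonneg_right (hb (x + t) (by linarith)).2 (norm_nonneg _)).trans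
        (hmono (norm_nonneg _) (by linarith) hst)
  · have hx' : 0 < x := hx
    have h := hmono (x := x) zero_le_one (by linarith) hst
    rw [mul_one] at h
    exact (hb (x + t) (by linarith)).1.trans h

theorem fredholmSeriesConverges_kKernel (hA : Admissible A) (s : ℝ) :
    FredholmSeriesConverges (kKernel A s) := by
  obtain ⟨C, c, _, _, h⟩ := hA.exists_rowDominated s
  exact (h s s le_rfl le_rfl).1.fredholmSeriesConverges

theorem tendsto_fredholmDet (hA : Admissible A) :
    Tendsto (fun s => fredholmDet (kKernel A s)) atTop (nhds 1) := by
  obtain ⟨C, c, _, hc, h⟩ := hA.exists_rowDominated 0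
  let L : ℝ → ℝ := fun s => ∫ x, C * Real.exp (-c * (s - 0)) * Real.exp (-c * x) ∂halfLine
  have hL : Tendsto L atTop (nhds 0) := by
    have hexp : Tendsto (fun s : ℝ => Real.exp (-c * s)) atTop (nhds 0) :=
      Real.tendsto_exp_atBot.comp (tendsto_id.const_mul_atTop_of_neg (neg_neg_iff_pos.2 hc))
    simpa only [L, integral_const_mul, sub_zero, mul_zero, zero_mul] using
      (hexp.const_mul C).mul_const (∫ x, Real.exp (-c * x) ∂halfLine)
  refine tendsto_iff_norm_sub_tendsto_zero.2 <| squeeze_zero' (.of_forall fun _ => norm_nonneg _)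
    ?_ (zero_mul (∑' n, hadamardBound 1 n) ▸ hL.mul_const _)
  filter_upwards [eventually_ge_atTop 0, hL.eventually_le_const zero_lt_one] with s hs hs1
  have hdom := (h s s hs le_rfl).1
  rw [fredholmDet_eq_detSeries]
  refine hdom.abs_detSeries_sub_one_le.trans
    (mul_le_mul_of_nonneg_left ?_ hdom.integral_weight_nonneg)
  refine (summable_hadamardBound _).tsum_le_tsum (fun n => ?_) (summable_hadamardBound _)
  have : 0 ≤ L s := hdom.integral_weight_nonneg
  change hadamardBound (L s) n ≤ _
  unfold hadamardBound
  gcongr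

theorem memLp_cramerSeries_kKernel (hA : Admissible A) (s : ℝ) :
    MemLp (cramerSeries halfLine (kKernel A s) fun x => A (x + s)) 2 halfLine := by
  obtain ⟨C, c, _, hc, h⟩ := hA.exists_rowDominated s
  obtain ⟨hdom, ha⟩ := h s s le_rfl le_rfl
  exact hdom.memLp_cramerSeries (hA.measurable_comp_add_right s) ha ((memLp_exp hc).const_mul _)

theorem toLp_cramerSeries_kKernel (hA : Admissible A) (s : ℝ) :
    (memLp_cramerSeries_kKernel hA s).toLp _ =
      fredholmDet (kKernel A s) • resolvent hA s (aVec hA s) := by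
  obtain ⟨C, c, _, _, h⟩ := hA.exists_rowDominated s
  obtain ⟨hdom, ha⟩ := h s s le_rfl le_rfl
  set E : L2 := (memLp_cramerSeries_kKernel hA s).toLp _
  have hE : E =ᵐ[halfLine] cramerSeries halfLine (kKernel A s) fun x => A (x + s) :=
    (memLp_cramerSeries_kKernel hA s).coeFn_toLp
  have hfred : E = fredholmDet (kKernel A s) • aVec hA s + kOp hA s E := by
    refine Lp.ext ?_
    filter_upwards [Lp.coeFn_add (fredholmDet (kKernel A s) • aVec hA s) (kOp hA s E),
      Lp.coeFn_smul (fredholmDet (kKernel A s)) (aVec hA s), hE,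
      (memLp_aKernel_zero hA s).coeFn_toLp, kernelOperator_apply_ae (memLp_kKernel hA s) E,
      hdom.ae_mem] with x hadd hsmul hEx hax hKx hx
    rw [hadd, Pi.add_apply, hsmul, Pi.smul_apply, aVec, hax, kOp, hKx, hEx,
      hdom.cramerSeries_eq (hA.measurable_comp_add_right s) ha hx, fredholmDet_eq_detSeries,
      smul_eq_mul, aKernel, add_zero]
    congr 1
    refine integral_congr_ae ?_
    filter_upwards [hE] with y hy
    rw [hy]
  rw [← map_smul, ← sub_eq_iff_eq_add.2 hfred, resolvent_sub_kOp]

theorem hasDerivAt_fredholmDet (hA : Admissible A) (s : ℝ) :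
    HasDerivAt (fun t => fredholmDet (kKernel A t)) (fredholmDet (kKernel A s) * u₀ hA s) s := by
  obtain ⟨C, c, hC, hc, h⟩ := hA.exists_rowDominated (s - 1)
  have hdom := fun t (ht : t ∈ Ioi (s - 1)) => h (s - 1) t le_rfl (le_of_lt ht)
  have hbound : ∀ t ∈ Ioi (s - 1), ∀ x ∈ Ioi (0 : ℝ), |A (x + t)| ≤ C := fun t ht x hx => by
    refine ((hdom t ht).2 x hx).trans ?_
    rw [sub_self, mul_zero, Real.exp_zero, mul_one]
    refine mul_le_of_le_one_right hC (Real.exp_le_one_iff.2 ?_)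
    exact mul_nonpos_of_nonpos_of_nonneg (neg_nonpos.2 hc.le) (le_of_lt hx)
  have hmeas := fun t (_ : t ∈ Ioi (s - 1)) => hA.measurable_comp_add_right t
  have hderiv := hasDerivAt_detSeries isOpen_Ioi (fun t ht => (hdom t ht).1) hmeas
    (fun t ht => (hdom t ht).2) hmeas hbound (fun t _ x _ y _ => hasDerivAt_kKernel hA t x y)
    isPreconnected_Ioi (sub_one_lt s)
  simp only [fredholmDet_eq_detSeries]
  refine hderiv.congr_deriv ?_
  rw [← fredholmDet_eq_detSeries, u₀, ← inner_smul_right, ← toLp_cramerSeries_kKernel, inner_aVec]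
  refine integral_congr_ae ?_
  filter_upwards [(memLp_cramerSeries_kKernel hA s).coeFn_toLp] with x hx
  rw [hx]

end FredholmDeterminant

section Resolvent

theorem hasDerivAt_ringInverse {𝕜 R : Type*} [NontriviallyNormedField 𝕜] [NormedRing R]
    [HasSummableGeomSeries R] [NormedAlgebra 𝕜 R] {f : 𝕜 → R} {f' : R} {t : 𝕜}
    (hf : HasDerivAt f f' t) (hu : IsUnit (f t)) :
    HasDerivAt (fun τ => Ring.inverse (f τ))
      (-(Ring.inverse (f t) * f' * Ring.inverse (f t))) t := by
  obtain ⟨u, hu⟩ := hu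
  rw [← hu, Ring.inverse_unit]
  have hinv := hasFDerivAt_ringInverse (𝕜 := 𝕜) u
  rw [hu] at hinv
  exact hinv.comp_hasDerivAt t hf

variable {A : ℝ → ℝ}

theorem resolvent_sub_kOp_resolvent (hA : Admissible A) (s : ℝ) (f : L2) :
    resolvent hA s f - kOp hA s (resolvent hA s f) = f :=
  congrArg (fun T : L2 →L[ℝ] L2 => T f) (Ring.mul_inverse_cancel _ (isUnit_one_sub_kOp hA s))

theorem inner_resolvent_comm (hA : Admissible A) (s : ℝ) (f g : L2) :
    inner ℝ (resolvent hA s f) g = inner ℝ f (resolvent hA s g) :=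
  ((IsSelfAdjoint.one (L2 →L[ℝ] L2)).sub (isSelfAdjoint_kOp hA s)).ringInverse.isSymmetric f g

theorem aOp_resolvent (hA : Admissible A) (s : ℝ) (f : L2) :
    aOp hA s (resolvent hA s f) = resolvent hA s (aOp hA s f) := by
  rw [← resolvent_sub_kOp hA s (aOp hA s (resolvent hA s f)), kOp_aOp, ← map_sub,
    resolvent_sub_kOp_resolvent]

theorem hasDerivAt_resolvent (hA : Admissible A) (s : ℝ) :
    HasDerivAt (resolvent hA) (-(resolvent hA s *
      InnerProductSpace.rankOne ℝ (aVec hA s) (aVec hA s) * resolvent hA s)) s := by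
  have h := (hasDerivAt_kOp hA s).const_sub 1
  rw [neg_neg] at h
  exact hasDerivAt_ringInverse h (isUnit_one_sub_kOp hA s)

theorem tendsto_resolvent (hA : Admissible A) : Tendsto (resolvent hA) atTop (nhds 1) := by
  have hK : Tendsto (fun s => 1 - kOp hA s) atTop (nhds 1) := by
    simpa only [kOp_eq_integral, sub_zero, id] using
      (tendsto_integral_Ioi_zero (μ := volume) tendsto_id).const_sub (1 : L2 →L[ℝ] L2)
  have hinv := NormedRing.inverse_continuousAt (1 : (L2 →L[ℝ] L2)ˣ)
  rw [ContinuousAt, Units.val_one, Ring.inverse_one] at hinv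
  exact hinv.comp hK

/- The derivative of `A` need not be square integrable at `+∞`, so `aVec` may fail to be
differentiable; `kVec` is differentiable. -/
theorem u₀_eq (hA : Admissible A) (s : ℝ) :
    u₀ hA s = ‖aVec hA s‖ ^ 2 + inner ℝ (kVec hA s) (resolvent hA s (kVec hA s)) := by
  have hsplit : resolvent hA s (aVec hA s) =
      aVec hA s + resolvent hA s (kOp hA s (aVec hA s)) := by
    rw [← sub_eq_iff_eq_add, ← map_sub, resolvent_sub_kOp]
  rw [← aOp_aVec, inner_aOp_comm, aOp_resolvent, aOp_aOp, u₀, hsplit, inner_add_right,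
    real_inner_self_eq_norm_sq]

theorem hasDerivAt_u₀ (hA : Admissible A) (s : ℝ) : HasDerivAt (u₀ hA) (-(q₀ hA s) ^ 2) s := by
  have hRk := (hasDerivAt_resolvent hA s).clm_apply (hasDerivAt_kVec hA s)
  have hderiv := (hasDerivAt_norm_aVec_sq hA s).add ((hasDerivAt_kVec hA s).inner ℝ hRk)
  have hsymm : inner ℝ (kVec hA s) (resolvent hA s (aVec hA s)) =
      inner ℝ (aVec hA s) (resolvent hA s (kVec hA s)) := by
    rw [← inner_resolvent_comm, real_inner_comm]
  rw [funext (u₀_eq hA)]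
  refine hderiv.congr_deriv ?_
  simp only [neg_apply, mul_apply_eq_comp, InnerProductSpace.rankOne_apply, map_neg, map_smul,
    inner_add_right, inner_neg_right, inner_neg_left, real_inner_smul_left, real_inner_smul_right,
    hsymm, q₀]
  ring

theorem continuous_u₀ (hA : Admissible A) : Continuous (u₀ hA) :=
  continuous_iff_continuousAt.2 fun s => (hasDerivAt_u₀ hA s).continuousAt

theorem integrableOn_u₀ (hA : Admissible A) (s : ℝ) : IntegrableOn (u₀ hA) (Ioi s) := by
  obtain ⟨C, c, _, hc, hb⟩ := hA.exists_norm_aVec_le 0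
  have haO : (fun t => ‖aVec hA t‖) =O[atTop] fun t => Real.exp (-c * t) := by
    refine .of_bound C ?_
    filter_upwards [eventually_ge_atTop 0] with t ht
    simpa using (hb t ht).2
  have hRO : (fun t => ‖resolvent hA t‖) =O[atTop] fun _ => (1 : ℝ) :=
    (tendsto_resolvent hA).norm.isBigO_one ℝ
  refine integrable_of_isBigO_exp_neg (b := c + c) (by positivity)
    (continuous_u₀ hA).continuousOn ?_
  refine (Asymptotics.IsBigO.of_norm_le fun t => ?_).trans
    ((haO.mul (hRO.mul haO)).congr_right fun t => ?_)
  · exact (norm_inner_le_norm _ _).trans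
      (mul_le_mul_of_nonneg_left ((resolvent hA t).le_opNorm _) (norm_nonneg _))
  · rw [one_mul, ← Real.exp_add]
    ring_nf

theorem fredholmDet_eq_exp (hA : Admissible A) (s : ℝ) :
    fredholmDet (kKernel A s) = Real.exp (-∫ t in Ioi s, u₀ hA t) :=
  eq_exp_neg_integral_Ioi_of_hasDerivAt (continuous_u₀ hA) (integrableOn_u₀ hA)
    (hasDerivAt_fredholmDet hA) (tendsto_fredholmDet hA) s

theorem fredholmDet_pos (hA : Admissible A) (s : ℝ) : 0 < fredholmDet (kKernel A s) :=
  fredholmDet_eq_exp hA s ▸ Real.exp_pos _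

theorem hasDerivAt_log_fredholmDet (hA : Admissible A) (s : ℝ) :
    HasDerivAt (fun t => Real.log (fredholmDet (kKernel A t))) (u₀ hA s) s :=
  ((hasDerivAt_fredholmDet hA s).log (fredholmDet_pos hA s).ne').congr_deriv
    (mul_div_cancel_left₀ _ (fredholmDet_pos hA s).ne')

end Resolvent

end TauRep

end

theorem mainTheorem2 (A : ℝ → ℝ) (hA : TauRep.Admissible A) :
    (∀ s : ℝ, IsUnit (1 - TauRep.kOp hA s) ∧
      TauRep.FredholmSeriesConverges (TauRep.kKernel A s) ∧
      0 < TauRep.fredholmDet (TauRep.kKernel A s)) ∧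
    (∀ s : ℝ,
      HasDerivAt (fun t : ℝ => Real.log (TauRep.fredholmDet (TauRep.kKernel A t)))
        (TauRep.u₀ hA s) s) ∧
    (∀ s : ℝ,
      HasDerivAt (deriv fun t : ℝ => Real.log (TauRep.fredholmDet (TauRep.kKernel A t)))
        (-(TauRep.q₀ hA s) ^ 2) s) ∧
    (∀ s : ℝ,
      MeasureTheory.IntegrableOn (TauRep.u₀ hA) (Set.Ioi s) ∧
      TauRep.fredholmDet (TauRep.kKernel A s) =
        Real.exp (-∫ t in Set.Ioi s, TauRep.u₀ hA t)) := by
  refine ⟨fun s => ⟨TauRep.isUnit_one_sub_kOp hA s, TauRep.fredholmSeriesConverges_kKernel hA s,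
    TauRep.fredholmDet_pos hA s⟩, TauRep.hasDerivAt_log_fredholmDet hA, fun s => ?_,
    fun s => ⟨TauRep.integrableOn_u₀ hA s, TauRep.fredholmDet_eq_exp hA s⟩⟩
  rw [funext fun t => (TauRep.hasDerivAt_log_fredholmDet hA t).deriv]
  exact TauRep.hasDerivAt_u₀ hA s
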